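/- Let $N\ge 1$ be an integer. All functions $u$ below are complex-valued, $L^2(\mathbb{R}^N)=L^2(\mathbb{R}^N;\mathbb{C})$, and for $k\in\mathbb{Z}^N$ let $Q_k=k+(0,1)^N$ be the open unit cubes of the lattice. Let $A\in L^2_{\mathrm{loc}}(\mathbb{R}^N;\mathbb{R}^N)$ satisfy: - if $N\ge 3$: $A\in L^N_{\mathrm{loc}}(\mathbb{R}^N;\mathbb{R}^N)$ and $\sup_{k}\|A\|_{L^N(Q_k)}<\infty$; - if $N=2$: for some $\varepsilon>0$, $A\in L^{2+\varepsilon}_{\mathrm{loc}}(\mathbb{R}^2;\mathbb{R}^2)$ and $\sup_{k}\|A\|_{L^{2+\varepsilon}(Q_k)}<\infty$; - if $N=1$: $\sup_{k}\|A\|_{L^2(Q_k)}<\infty$. Let $V\in L^1_{\mathrm{loc}}(\mathbb{R}^N;\mathbb{R})$ satisfy $\operatorname{ess\,inf}_{\mathbb{R}^N}V>0$ and: - if $N\ge 3$: $V\in L^{N/2}_{\mathrm{loc}}(\mathbb{R}^N;\mathbb{R})$ and $\sup_{k}\|V\|_{L^{N/2}(Q_k)}<\infty$; - if $N=2$: for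 some $\varepsilon>0$, $V\in L^{1+\varepsilon}_{\mathrm{loc}}(\mathbb{R}^2;\mathbb{R})$ and $\sup_{k}\|V\|_{L^{1+\varepsilon}(Q_k)}<\infty$; - if $N=1$: $\sup_{k}\|V\|_{L^1(Q_k)}<\infty$. For $u\in L^2(\mathbb{R}^N)$ let $\nabla_A u=\nabla u+\mathrm{i}Au$ in the sense of distributions, and let $$H^1_{A,V}(\mathbb{R}^N)=\Big\{u\in L^2(\mathbb{R}^N):\ Vu^2\in L^1(\mathbb{R}^N)\ \text{ and }\ \nabla_A u\in L^2(\mathbb{R}^N;\mathbb{C}^N)\Big\},$$ $$\|u\|_{H^1_{A,V}(\mathbb{R}^N)}^2=\int_{\mathbb{R}^N}V|u|^2\,dx+\|\nabla_A u\|_{L^2(\mathbb{R}^N)}^2,$$ and let $H^1(\mathbb{R}^N)=\{u\in L^2(\mathbb{R}^N):\nabla u\in L^2(\mathbb{R}^N;\mathbb{C}^N)\}$ with $\|u\|_{H^1(\mathbb{R}^N)}^2=\|u\|_{L^2(\mathbb{R}^N)}^2+\|\nabla u\|_{L^2(\mathbb{R}^N)}^2$. Then $H^1_{A,V}(\mathbb{R}^N)=H^1(\mathbb{R}^N)$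 with equivalent norms: the two sets coincide and there are constants $c,C>0$ such that $c\,\|u\|_{H^1(\mathbb{R}^N)}\le\|u\|_{H^1_{A,V}(\mathbb{R}^N)}\le C\,\|u\|_{H^1(\mathbb{R}^N)}$ for all $u\in H^1(\mathbb{R}^N)$. -/

import Mathlib

open MeasureTheory Complex
open scoped ENNReal ContDiff

namespace MagneticSobolev

noncomputable section

/-- The space `ℝ^N` with its Euclidean norm. -/
abbrev Space (N : ℕ) : Type := EuclideanSpace ℝ (Fin N)

/-- The complex Hilbert space `L²(ℝ^N; ℂ)`; its elements are classes of functions. -/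
abbrev L2 (N : ℕ) : Type := Lp ℂ 2 (volume : Measure (Space N))

/-- The space `L²(ℝ^N; ℂ^N)`, where `ℂ^N` has its Hermitian norm. -/
abbrev L2Vec (N : ℕ) : Type := Lp (EuclideanSpace ℂ (Fin N)) 2 (volume : Measure (Space N))

/-- The `j`-th partial derivative `∂_j φ(x)`. -/
def partialDeriv {N : ℕ} (j : Fin N) (φ : Space N → ℂ) (x : Space N) : ℂ :=
  fderiv ℝ φ x (EuclideanSpace.single j 1)

/-- `φ` is a test function: smooth with compact support. -/
def IsTestFunction {N : ℕ} (φ : Space N → ℂ) : Prop :=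
  ContDiff ℝ ∞ φ ∧ HasCompactSupport φ

/-- `f ∈ L^p_loc(ℝ^N; F)`. -/
def MemLpLoc {N : ℕ} {F : Type*} [NormedAddCommGroup F] (p : ℝ≥0∞) (f : Space N → F) : Prop :=
  ∀ K : Set (Space N), IsCompact K → MemLp f p (volume.restrict K)

/-- The open unit cube `k + (0,1)^N`, for `k ∈ ℤ^N`. -/
def unitCube {N : ℕ} (k : Fin N → ℤ) : Set (Space N) :=
  {x | ∀ j, (k j : ℝ) < x j ∧ x j < (k j : ℝ) + 1}

/-- `f ∈ L^p_loc(ℝ^N; F)` and its `L^p` norms over the unit cubes of the lattice `ℤ^N` are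
bounded. -/
def UnifMemLpLoc {N : ℕ} {F : Type*} [NormedAddCommGroup F] (p : ℝ≥0∞) (f : Space N → F) : Prop :=
  MemLpLoc p f ∧ (⨆ k : Fin N → ℤ, eLpNorm f p (volume.restrict (unitCube k))) < ⊤

/-- The integrability condition on the magnetic potential: uniformly local `L^N` if `N ≥ 3`,
uniformly local `L^{2+ε}` for some `ε > 0` if `N = 2`, uniformly local `L²` if `N = 1`. -/
def MagneticCondition {N : ℕ} (A : Space N → Space N) : Prop :=
  (3 ≤ N → UnifMemLpLoc (N : ℝ≥0∞) A) ∧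
  (N = 2 → ∃ ε : ℝ, 0 < ε ∧ UnifMemLpLoc (ENNReal.ofReal (2 + ε)) A) ∧
  (N = 1 → UnifMemLpLoc 2 A)

/-- The integrability condition on the electric potential: uniformly local `L^{N/2}` if `N ≥ 3`,
uniformly local `L^{1+ε}` for some `ε > 0` if `N = 2`, uniformly local `L¹` if `N = 1`. -/
def ElectricCondition {N : ℕ} (V : Space N → ℝ) : Prop :=
  (3 ≤ N → UnifMemLpLoc ((N : ℝ≥0∞) / 2) V) ∧
  (N = 2 → ∃ ε : ℝ, 0 < ε ∧ UnifMemLpLoc (ENNReal.ofReal (1 + ε)) V) ∧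
  (N = 1 → UnifMemLpLoc 1 V)

/-- `G = ∇u` in the sense of distributions. -/
def IsWeakGrad {N : ℕ} (u : L2 N) (G : L2Vec N) : Prop :=
  ∀ φ : Space N → ℂ, IsTestFunction φ → ∀ j : Fin N,
    ∫ x, G x j * φ x = -∫ x, u x * partialDeriv j φ x

/-- `G = ∇u + i A u` in the sense of distributions. For `A ∈ L²_loc` and `u ∈ L²` the product
`A u` is locally integrable, so that it is a distribution. -/
def IsMagneticGrad {N : ℕ} (A : Space N → Space N) (u : L2 N) (G : L2Vec N) : Prop :=
  ∀ φ : Space N → ℂ, IsTestFunction φ → ∀ j : Fin N,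
    ∫ x, G x j * φ x =
      (-∫ x, u x * partialDeriv j φ x) + I * ∫ x, (A x j : ℂ) * u x * φ x

/-- An `L²` vector field is determined by its action on test functions. -/
theorem eq_of_test {N : ℕ} {G G' : L2Vec N}
    (h : ∀ φ : Space N → ℂ, IsTestFunction φ → ∀ j : Fin N,
      ∫ x, G x j * φ x = ∫ x, G' x j * φ x) : G = G' := by
  have hloc : ∀ (F : L2Vec N) (j : Fin N),
      LocallyIntegrable (fun x => F x j) (volume : Measure (Space N)) := by
    intro F j
    have h1 : LocallyIntegrable (fun x => F x) (volume : Measure (Space N)) :=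
      (Lp.memLp F).locallyIntegrable (by norm_num)
    intro x
    obtain ⟨s, hs, hi⟩ := h1 x
    exact ⟨s, hs, (EuclideanSpace.proj (𝕜 := ℂ) j).integrable_comp hi⟩
  have key : ∀ j : Fin N, ∀ᵐ x : Space N, G x j = G' x j := by
    intro j
    refine ae_eq_of_integral_contDiff_smul_eq (hloc G j) (hloc G' j) ?_
    intro g hg hc
    have h2 := h (fun x => (g x : ℂ))
      ⟨Complex.ofRealCLM.contDiff.comp hg, hc.comp_left (g := Complex.ofReal) (by simp)⟩ j
    simpa [Complex.real_smul, mul_comm] using h2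
  apply Lp.ext
  filter_upwards [ae_all_iff.2 key] with x hx
  ext j
  exact hx j

theorem IsWeakGrad.unique {N : ℕ} {u : L2 N} {G G' : L2Vec N}
    (h : IsWeakGrad u G) (h' : IsWeakGrad u G') : G = G' :=
  eq_of_test fun φ hφ j => (h φ hφ j).trans (h' φ hφ j).symm

theorem IsMagneticGrad.unique {N : ℕ} {A : Space N → Space N} {u : L2 N} {G G' : L2Vec N}
    (h : IsMagneticGrad A u G) (h' : IsMagneticGrad A u G') : G = G' :=
  eq_of_test fun φ hφ j => (h φ hφ j).trans (h' φ hφ j).symm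

open Classical in
/-- The weak gradient `∇u` of `u ∈ L²` if it is in `L²` (it is unique); `0` otherwise. -/
def weakGrad {N : ℕ} (u : L2 N) : L2Vec N :=
  if h : ∃ G, IsWeakGrad u G then h.choose else 0

open Classical in
/-- The magnetic gradient `∇_A u = ∇u + i A u` of `u ∈ L²` if it is in `L²` (it is unique);
`0` otherwise. -/
def magneticGrad {N : ℕ} (A : Space N → Space N) (u : L2 N) : L2Vec N :=
  if h : ∃ G, IsMagneticGrad A u G then h.choose else 0

theorem IsWeakGrad.weakGrad_eq {N : ℕ} {u : L2 N} {G : L2Vec N} (h : IsWeakGrad u G) :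
    weakGrad u = G := by
  have h1 : ∃ G, IsWeakGrad u G := ⟨G, h⟩
  rw [weakGrad, dif_pos h1]
  exact h1.choose_spec.unique h

theorem IsMagneticGrad.magneticGrad_eq {N : ℕ} {A : Space N → Space N} {u : L2 N} {G : L2Vec N}
    (h : IsMagneticGrad A u G) : magneticGrad A u = G := by
  have h1 : ∃ G, IsMagneticGrad A u G := ⟨G, h⟩
  rw [magneticGrad, dif_pos h1]
  exact h1.choose_spec.unique h

/-- The Sobolev space `H¹(ℝ^N)`, as a subset of `L²(ℝ^N; ℂ)`. -/
def H1 (N : ℕ) : Set (L2 N) := {u | ∃ G, IsWeakGrad u G}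

/-- The norm of `H¹(ℝ^N)`: the square root of `‖u‖²_{L²} + ‖∇u‖²_{L²}`. -/
def H1norm {N : ℕ} (u : L2 N) : ℝ := √(‖u‖ ^ 2 + ‖weakGrad u‖ ^ 2)

/-- The space `H¹_{A,V}(ℝ^N)`, as a subset of `L²(ℝ^N; ℂ)`: `V u² ∈ L¹` and `∇_A u ∈ L²`. -/
def H1AV {N : ℕ} (A : Space N → Space N) (V : Space N → ℝ) : Set (L2 N) :=
  {u | Integrable (fun x => (V x : ℂ) * u x ^ 2) ∧ ∃ G, IsMagneticGrad A u G}

/-- The norm of `H¹_{A,V}(ℝ^N)`: the square root of `∫ V |u|² + ‖∇_A u‖²_{L²}`. -/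
def H1AVnorm {N : ℕ} (A : Space N → Space N) (V : Space N → ℝ) (u : L2 N) : ℝ :=
  √((∫ x, V x * ‖u x‖ ^ 2) + ‖magneticGrad A u‖ ^ 2)

end

end MagneticSobolev

namespace MagneticSobolev

noncomputable section

open Filter
open scoped NNReal Topology Convolution ComplexConjugate

/-! The two gradients differ by `i A u`, so everything reduces to weighted bounds `∫ w²|u|² ≤ C
(‖u‖² + ‖G‖²)` with `w = |A|` or `w = |V|^{1/2}`, where `G` may be either `∇u` or `∇_A u`.

For `C¹` functions such a bound is local: on a unit cube, Hölder with `1/r + 1/q = 1/2` and the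
Sobolev inequality for a cut-off function bound the integral by the `H¹` energy on a fixed larger
ball. The constant is the same for every cube because the `L^r` norms of `w` are uniformly bounded,
and the balls overlap boundedly often, so the bounds can be summed
(`isSobolevWeight_of_localSobolev`). Mollification and Fatou extend the estimate to weakly
differentiable functions (`IsSobolevWeight.lintegral_le`).

The bound by `∇_A u` is the diamagnetic argument. Apply the estimate to a regularization of `|u|`:
its weak gradient is the real part of a factor of modulus at most one times `∇u`. In that real part
the term `i A u` disappears, so `∇u` may be replaced by `∇_A u`
(`IsSobolevWeight.lintegral_le_magnetic`). The constant does not depend on the magnetic field, and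
the field `0` gives the bound by `∇u`.

Hence `A u ∈ L²` as soon as one gradient is in `L²`, and each gradient controls the other. The
weight `|V|^{1/2}` bounds the electric energy from above, and the positive essential infimum of `V`
bounds it from below by `‖u‖²`. -/

theorem eLpNorm_two_sq {α F : Type*} [MeasurableSpace α] [NormedAddCommGroup F] (f : α → F)
    (μ : Measure α) : eLpNorm f 2 μ ^ 2 = ∫⁻ x, ‖f x‖ₑ ^ 2 ∂μ := by
  rw [eLpNorm_eq_lintegral_rpow_enorm_toReal (by norm_num) (by norm_num)]
  simp only [ENNReal.toReal_ofNat, ENNReal.rpow_ofNat]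
  rw [← ENNReal.rpow_natCast, ← ENNReal.rpow_mul]
  norm_num

/-! ### Sobolev inequalities for functions with bounded support -/

/-- The norm of the derivative of `f`. -/
def gradNorm {E : Type*} [NormedAddCommGroup E] [NormedSpace ℝ E] (f : E → ℂ) (x : E) : ℝ :=
  ‖fderiv ℝ f x‖

theorem continuous_gradNorm {E : Type*} [NormedAddCommGroup E] [NormedSpace ℝ E] {f : E → ℂ}
    (hf : ContDiff ℝ 1 f) : Continuous (gradNorm f) :=
  (hf.continuous_fderiv one_ne_zero).norm

theorem support_gradNorm_subset {E : Type*} [NormedAddCommGroup E] [NormedSpace ℝ E] (f : E → ℂ) :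
    Function.support (gradNorm f) ⊆ tsupport f := fun x hx =>
  support_fderiv_subset ℝ fun h => hx (by rw [gradNorm, h, norm_zero])

/-- The Sobolev inequality `‖f‖_q ≤ C ‖∇f‖_2` for functions supported in a bounded set. -/
def LocalSobolev (N : ℕ) (q : ℝ≥0∞) : Prop :=
  ∀ s : Set (Space N), Bornology.IsBounded s → ∃ C : ℝ≥0, ∀ f : Space N → ℂ, ContDiff ℝ 1 f →
    Function.support f ⊆ s → eLpNorm f q volume ≤ C * eLpNorm (gradNorm f) 2 volume

/-- Hölder on the set `closure s`, which has finite measure and carries the gradient. -/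
theorem eLpNorm_fderiv_le_of_support_subset {N : ℕ} {p : ℝ≥0∞} (hp0 : 0 < p) (hp : p ≤ 2)
    {s : Set (Space N)} (hs : Bornology.IsBounded s) :
    ∃ C : ℝ≥0, ∀ f : Space N → ℂ, ContDiff ℝ 1 f → Function.support f ⊆ s →
      eLpNorm (gradNorm f) p volume ≤ C * eLpNorm (gradNorm f) 2 volume := by
  have hfin : volume (closure s) < ⊤ := hs.isCompact_closure.measure_lt_top
  have hexp : 0 ≤ 1 / p.toReal - 1 / (2 : ℝ≥0∞).toReal := by
    have h1 : p.toReal ≤ (2 : ℝ≥0∞).toReal := ENNReal.toReal_mono (by simp) hp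
    have h2 : 0 < p.toReal := ENNReal.toReal_pos hp0.ne' (ne_top_of_le_ne_top (by simp) hp)
    have := one_div_le_one_div_of_le h2 h1
    linarith
  have hne : (volume (closure s)) ^ (1 / p.toReal - 1 / (2 : ℝ≥0∞).toReal) ≠ ⊤ :=
    ENNReal.rpow_ne_top_of_nonneg hexp hfin.ne
  refine ⟨ENNReal.toNNReal ((volume (closure s)) ^ (1 / p.toReal - 1 / (2 : ℝ≥0∞).toReal)), ?_⟩
  intro f hf hsupp
  rw [ENNReal.coe_toNNReal hne]
  have h1 : Function.support (gradNorm f) ⊆ closure s :=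
    (support_gradNorm_subset f).trans (closure_mono hsupp)
  rw [← eLpNorm_restrict_eq_of_support_subset (p := p) (μ := volume) h1,
    ← eLpNorm_restrict_eq_of_support_subset (p := 2) (μ := volume) h1, mul_comm]
  have h2 := eLpNorm_le_eLpNorm_mul_rpow_measure_univ (μ := volume.restrict (closure s)) hp
    (continuous_gradNorm hf).aestronglyMeasurable
  rwa [Measure.restrict_apply_univ] at h2

/-- Gagliardo–Nirenberg–Sobolev with the gradient in `L^p`, then Hölder to reach `L²`. Exponents `p
< 2` are needed for `N = 2`, where `p = 2` is excluded by `p < N`. -/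
theorem localSobolev_of_le {N : ℕ} {p q : ℝ≥0} (hp : 1 ≤ p) (hp2 : p ≤ 2) (hpN : (p : ℝ) < N)
    (hpq : (p : ℝ)⁻¹ - (N : ℝ)⁻¹ ≤ (q : ℝ)⁻¹) : LocalSobolev N q := by
  intro s hs
  obtain ⟨C, hC⟩ := eLpNorm_fderiv_le_of_support_subset (N := N) (p := p)
    (by exact_mod_cast zero_lt_one.trans_le hp) (by exact_mod_cast hp2) hs
  refine ⟨eLpNormLESNormFDerivOfLeConst ℂ (volume : Measure (Space N)) s p q * C, ?_⟩
  intro f hf hsupp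
  have h1 := eLpNorm_le_eLpNorm_fderiv_of_le (μ := (volume : Measure (Space N))) (p := p) (q := q)
    hf hsupp hp (by rw [finrank_euclideanSpace_fin]; exact_mod_cast hpN) (by simpa using hpq) hs
  rw [← eLpNorm_norm (fderiv ℝ f)] at h1
  refine h1.trans ?_
  rw [ENNReal.coe_mul, mul_assoc]
  gcongr
  exact hC f hf hsupp

/-- In one dimension a compactly supported function is the integral of its derivative, so the
supremum is at most the `L¹` norm of the gradient. The map `t ↦ t • e` carries this from `ℝ` to
`Space 1`. -/
theorem localSobolev_one : LocalSobolev 1 ⊤ := by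
  intro s hs
  obtain ⟨C, hC⟩ := eLpNorm_fderiv_le_of_support_subset (N := 1) (p := 1) (by simp)
    (by norm_num) hs
  refine ⟨C, fun f hf hsupp => le_trans ?_ (hC f hf hsupp)⟩
  have hcs : HasCompactSupport f :=
    hs.isCompact_closure.of_isClosed_subset (isClosed_tsupport f) (closure_mono hsupp)
  set e : Space 1 := EuclideanSpace.single 0 1 with he
  have hx : ∀ x : Space 1, x = x 0 • e := by
    intro x; ext j; fin_cases j; simp [he]
  have hmp : MeasurePreserving (fun t : ℝ => t • e) := by
    have h1 := (volume_preserving_funUnique (Fin 1) ℝ).symm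
    have h2 := (PiLp.volume_preserving_toLp (Fin 1)).comp h1
    have h3 : (fun t : ℝ => t • e) =
        WithLp.toLp 2 ∘ (MeasurableEquiv.funUnique (Fin 1) ℝ).symm := by
      funext t
      refine PiLp.ext fun j => ?_
      fin_cases j
      simp [he]
    rw [h3]
    exact h2
  have hemb : MeasurableEmbedding (fun t : ℝ => t • e) := by
    refine Topology.IsClosedEmbedding.measurableEmbedding ?_
    refine (AddMonoidHomClass.isometry_of_norm (LinearMap.toSpanSingleton ℝ (Space 1) e) ?_
      ).isClosedEmbedding
    intro t
    simp [he, norm_smul]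
  rw [eLpNorm_exponent_top]
  refine eLpNormEssSup_le_of_ae_enorm_bound (Eventually.of_forall fun x => ?_)
  have hg : ContDiff ℝ 1 (fun t : ℝ => f (t • e)) := hf.comp (contDiff_id.smul contDiff_const)
  have hgc : HasCompactSupport (fun t : ℝ => f (t • e)) := by
    refine hcs.comp_isClosedEmbedding (g := fun t : ℝ => t • e) ?_
    refine (AddMonoidHomClass.isometry_of_norm (LinearMap.toSpanSingleton ℝ (Space 1) e) ?_
      ).isClosedEmbedding
    intro t
    simp [he, norm_smul]
  have hderiv : ∀ t : ℝ, deriv (fun t : ℝ => f (t • e)) t = fderiv ℝ f (t • e) e := by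
    intro t
    have h1 : HasDerivAt (fun t : ℝ => t • e) e t := by
      simpa using (hasDerivAt_id t).smul_const e
    exact ((hf.differentiable one_ne_zero _).hasFDerivAt.comp_hasDerivAt t h1).deriv
  have hbd : ∀ t : ℝ, ‖deriv (fun t : ℝ => f (t • e)) t‖ₑ ≤ ‖gradNorm f (t • e)‖ₑ := by
    intro t
    rw [hderiv, enorm_le_iff_norm_le, gradNorm, norm_norm]
    refine (ContinuousLinearMap.le_opNorm _ _).trans ?_
    simp [he]
  calc ‖f x‖ₑ = ‖(fun t : ℝ => f (t • e)) (x 0)‖ₑ := by simp only; rw [← hx x]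
    _ ≤ ∫⁻ t in Set.Iic (x 0), ‖deriv (fun t : ℝ => f (t • e)) t‖ₑ :=
        hgc.enorm_le_lintegral_Ici_deriv hg _
    _ ≤ ∫⁻ t, ‖gradNorm f (t • e)‖ₑ := (setLIntegral_le_lintegral _ _).trans (lintegral_mono hbd)
    _ = eLpNorm (gradNorm f) 1 volume := by
        rw [eLpNorm_one_eq_lintegral_enorm]
        exact hmp.lintegral_comp_emb hemb (fun x => ‖gradNorm f x‖ₑ)

/-! ### Unit cubes of the lattice and overlap of balls -/

/-- The lattice point `k`, as a vector of `ℝ^N`. -/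
def latticePoint {N : ℕ} (k : Fin N → ℤ) : Space N := WithLp.toLp 2 fun j => (k j : ℝ)

@[simp] theorem latticePoint_apply {N : ℕ} (k : Fin N → ℤ) (j : Fin N) :
    latticePoint k j = (k j : ℝ) := rfl

theorem measurableSet_unitCube {N : ℕ} (k : Fin N → ℤ) : MeasurableSet (unitCube k) := by
  have : unitCube k = ⋂ j, {x : Space N | (k j : ℝ) < x j ∧ x j < (k j : ℝ) + 1} := by
    ext x; simp [unitCube]
  rw [this]
  refine MeasurableSet.iInter fun j => ?_
  exact (EuclideanSpace.proj (𝕜 := ℝ) j).continuous.measurable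
    (measurableSet_Ioo (a := (k j : ℝ)) (b := (k j : ℝ) + 1))

theorem preimage_add_unitCube {N : ℕ} (k : Fin N → ℤ) :
    (fun x => x + latticePoint k) ⁻¹' unitCube k = unitCube (0 : Fin N → ℤ) := by
  ext x
  simp only [unitCube, Set.mem_preimage, Set.mem_ofPred_eq, PiLp.add_apply, latticePoint_apply,
    Pi.zero_apply, Int.cast_zero]
  refine forall_congr' fun j => ?_
  constructor <;> rintro ⟨h1, h2⟩ <;> constructor <;> linarith

theorem norm_le_of_mem_unitCube {N : ℕ} {x : Space N} (hx : x ∈ unitCube (0 : Fin N → ℤ)) :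
    ‖x‖ ≤ N := by
  rw [EuclideanSpace.norm_eq]
  refine Real.sqrt_le_iff.2 ⟨by positivity, ?_⟩
  have h1 : ∑ i, ‖x i‖ ^ 2 ≤ ∑ _i : Fin N, (1 : ℝ) := by
    refine Finset.sum_le_sum fun i _ => ?_
    have := hx i
    simp only [Pi.zero_apply, Int.cast_zero, zero_add] at this
    rw [Real.norm_eq_abs, sq_abs]
    nlinarith
  have h2 : ∑ _i : Fin N, (1 : ℝ) = N := by simp
  rw [h2] at h1
  rcases Nat.eq_zero_or_pos N with h | h
  · subst h; simp
  · have : (1 : ℝ) ≤ N := by exact_mod_cast h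
    nlinarith

theorem ae_mem_unitCube_floor {N : ℕ} :
    ∀ᵐ x : Space N, x ∈ unitCube (fun j => ⌊x j⌋) := by
  have h1 : ∀ (j : Fin N) (m : ℤ), ∀ᵐ x : Space N, x j ≠ (m : ℝ) := by
    intro j m
    have h2 : ∀ᵐ y : Fin N → ℝ, y j ≠ (m : ℝ) := by
      rw [ae_iff, volume_pi]
      simpa using Measure.pi_hyperplane (fun _ : Fin N => (volume : Measure ℝ)) j (m : ℝ)
    exact (PiLp.volume_preserving_ofLp (Fin N)).quasiMeasurePreserving.ae h2
  have h3 : ∀ᵐ x : Space N, ∀ (j : Fin N) (m : ℤ), x j ≠ (m : ℝ) :=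
    ae_all_iff.2 fun j => ae_all_iff.2 fun m => h1 j m
  filter_upwards [h3] with x hx j
  exact ⟨lt_of_le_of_ne (Int.floor_le _) (hx j _).symm, Int.lt_floor_add_one _⟩

theorem lintegral_le_tsum_unitCube {N : ℕ} (F : Space N → ℝ≥0∞) :
    ∫⁻ x, F x ≤ ∑' k : Fin N → ℤ, ∫⁻ x in unitCube k, F x := by
  have h1 : (volume : Measure (Space N)) = volume.restrict (⋃ k : Fin N → ℤ, unitCube k) := by
    refine (Measure.restrict_eq_self_of_ae_mem ?_).symm
    filter_upwards [ae_mem_unitCube_floor] with x hx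
    exact Set.mem_iUnion.2 ⟨_, hx⟩
  calc ∫⁻ x, F x = ∫⁻ x in ⋃ k : Fin N → ℤ, unitCube k, F x := by rw [← h1]
    _ ≤ _ := lintegral_iUnion_le _ _

theorem tsum_lintegral_closedBall_le {N : ℕ} (R : ℕ) (F : Space N → ℝ≥0∞) (hF : Measurable F) :
    ∑' k : Fin N → ℤ, ∫⁻ x in Metric.closedBall (latticePoint k) R, F x
      ≤ ((2 * R + 3) ^ N : ℕ) * ∫⁻ x, F x := by
  have h1 : ∀ k : Fin N → ℤ, ∫⁻ x in Metric.closedBall (latticePoint k) R, F x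
      = ∫⁻ x, (Metric.closedBall (latticePoint k) R).indicator F x := fun k =>
    (lintegral_indicator Metric.isClosed_closedBall.measurableSet _).symm
  simp_rw [h1]
  rw [← lintegral_tsum fun k => (hF.indicator Metric.isClosed_closedBall.measurableSet).aemeasurable,
    ← lintegral_const_mul _ hF]
  refine lintegral_mono fun x => ?_
  -- If `x` lies in the ball around `k`, then `|x j - k j| ≤ R`, so `k j` is within `R + 1` of `⌊x
  -- j⌋`. This leaves `2R + 3` integers per coordinate.
  set t : Finset (Fin N → ℤ) :=
    Fintype.piFinset fun j => Finset.Icc (⌊x j⌋ - (R + 1 : ℤ)) (⌊x j⌋ + (R + 1 : ℤ)) with ht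
  rw [tsum_eq_sum (s := t)]
  · calc ∑ k ∈ t, (Metric.closedBall (latticePoint k) (R : ℝ)).indicator F x ≤ ∑ _k ∈ t, F x :=
          Finset.sum_le_sum fun k _ => Set.indicator_le_self _ _ _
      _ = ((2 * R + 3) ^ N : ℕ) * F x := by
          rw [Finset.sum_const, nsmul_eq_mul, ht, Fintype.card_piFinset]
          congr 2
          simp only [Int.card_Icc]
          have : ∀ j : Fin N, (⌊x j⌋ + (R + 1 : ℤ) + 1 - (⌊x j⌋ - (R + 1 : ℤ))).toNat
              = 2 * R + 3 := by intro j; omega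
          simp [this]
  · intro k hk
    refine Set.indicator_of_notMem (fun hx => hk ?_) _
    rw [ht, Fintype.mem_piFinset]
    intro j
    have h2 : |x j - k j| ≤ R := by
      have h3 := PiLp.norm_apply_le (x - latticePoint k) j
      rw [Metric.mem_closedBall, dist_eq_norm] at hx
      simpa using h3.trans hx
    rw [abs_le] at h2
    have h4 := Int.floor_le (x j)
    have h5 := Int.lt_floor_add_one (x j)
    rw [Finset.mem_Icc]
    constructor
    · have : ((⌊x j⌋ - (R + 1 : ℤ) : ℤ) : ℝ) ≤ k j := by push_cast; linarith
      exact_mod_cast this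
    · have : (k j : ℝ) ≤ ((⌊x j⌋ + (R + 1 : ℤ) : ℤ) : ℝ) := by push_cast; linarith
      exact_mod_cast this

/-! ### Weighted estimate for `C¹` functions -/

theorem add_sq_le_two_mul (a b : ℝ≥0∞) : (a + b) ^ 2 ≤ 2 * (a ^ 2 + b ^ 2) := by
  have := ENNReal.rpow_add_le_mul_rpow_add_rpow a b (p := 2) (by norm_num)
  norm_num at this
  exact this

theorem enorm_fderiv_smul_sq_le {E : Type*} [NormedAddCommGroup E] [NormedSpace ℝ E]
    {χ : E → ℝ} {v : E → ℂ} {M : ℝ≥0} {x : E} (hχ : DifferentiableAt ℝ χ x)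
    (hv : DifferentiableAt ℝ v x) (h1 : ‖χ x‖ ≤ 1) (hM : ‖fderiv ℝ χ x‖ ≤ M) :
    ‖gradNorm (fun x => χ x • v x) x‖ₑ ^ 2 ≤
      2 * (M ^ 2 + 1) * (‖v x‖ₑ ^ 2 + ‖gradNorm v x‖ₑ ^ 2) := by
  have h2 : ‖fderiv ℝ (fun x => χ x • v x) x‖ ≤ ‖fderiv ℝ v x‖ + M * ‖v x‖ := by
    rw [fderiv_fun_smul hχ hv]
    refine (norm_add_le _ _).trans (add_le_add ?_ ?_)
    · rw [norm_smul]
      exact mul_le_of_le_one_left (norm_nonneg _) h1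
    · rw [ContinuousLinearMap.norm_smulRight_apply]
      gcongr
  have h3 : ‖gradNorm (fun x => χ x • v x) x‖ₑ ≤ ‖gradNorm v x‖ₑ + M * ‖v x‖ₑ := by
    simp only [enorm_eq_nnnorm, gradNorm, nnnorm_norm]
    exact_mod_cast h2
  calc ‖gradNorm (fun x => χ x • v x) x‖ₑ ^ 2 ≤ (‖gradNorm v x‖ₑ + M * ‖v x‖ₑ) ^ 2 := by gcongr
    _ ≤ 2 * (‖gradNorm v x‖ₑ ^ 2 + (M * ‖v x‖ₑ) ^ 2) := add_sq_le_two_mul _ _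
    -- The terms added here are superfluous but make `M ^ 2 + 1` a common factor.
    _ ≤ 2 * ((M ^ 2 * ‖gradNorm v x‖ₑ ^ 2 + ‖gradNorm v x‖ₑ ^ 2) +
        (M ^ 2 * ‖v x‖ₑ ^ 2 + ‖v x‖ₑ ^ 2)) := by
        rw [mul_pow]
        exact mul_le_mul_right (add_le_add le_add_self le_self_add) _
    _ = _ := by ring

theorem exists_cutoff_unitCube (N : ℕ) :
    ∃ (χ : Space N → ℝ) (M : ℝ≥0), ContDiff ℝ 1 χ ∧
      Function.support χ ⊆ Metric.closedBall (0 : Space N) (N + 2 : ℕ) ∧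
      (∀ x ∈ unitCube (0 : Fin N → ℤ), χ x = 1) ∧ (∀ x, ‖χ x‖ ≤ 1) ∧
      ∀ x, ‖fderiv ℝ χ x‖ ≤ M := by
  -- The unit cube lies in the ball of radius `N`, inside the region where this bump equals one.
  let χ : ContDiffBump (0 : Space N) := ⟨N + 1, N + 2, by positivity, by linarith⟩
  obtain ⟨M, hM⟩ := (χ.hasCompactSupport.fderiv ℝ).exists_bound_of_continuous
    ((χ.contDiff (n := 1)).continuous_fderiv one_ne_zero)
  refine ⟨χ, M.toNNReal, χ.contDiff, ?_, fun x hx => ?_, fun x => ?_,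
    fun x => (hM x).trans (Real.le_coe_toNNReal M)⟩
  · rw [χ.support_eq]
    refine Metric.ball_subset_closedBall.trans (Metric.closedBall_subset_closedBall ?_)
    simp [χ]
  · refine χ.one_of_mem_closedBall ?_
    rw [mem_closedBall_zero_iff]
    have := norm_le_of_mem_unitCube hx
    simp only [χ]
    linarith
  · rw [Real.norm_of_nonneg χ.nonneg]
    exact χ.le_one

theorem eLpNorm_real_smul_le {α : Type*} [MeasurableSpace α] {μ : Measure α} {p q r : ℝ≥0∞}
    [ENNReal.HolderTriple r q p] {w : α → ℝ} {f : α → ℂ}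
    (hw : AEStronglyMeasurable w μ) (hf : AEStronglyMeasurable f μ) :
    eLpNorm (fun x => w x • f x) p μ ≤ eLpNorm w r μ * eLpNorm f q μ := by
  have h : eLpNorm (w • f) p μ ≤ eLpNorm w r μ * eLpNorm f q μ := eLpNorm_smul_le_mul_eLpNorm hf hw
  exact h

/-- On the cube `v` equals `χ v`. Hölder splits off `w` in `L^r`, and the local Sobolev inequality
applied to `χ v` bounds the factor in `L^q`; the product rule then costs only the energy of `v` on
the ball. -/
theorem setLIntegral_unitCube_zero_le {N : ℕ} {q r : ℝ≥0∞} [ENNReal.HolderTriple r q 2]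
    (hq : LocalSobolev N q) :
    ∃ C : ℝ≥0, ∀ (w : Space N → ℝ) (v : Space N → ℂ),
      AEStronglyMeasurable w (volume.restrict (unitCube (0 : Fin N → ℤ))) → ContDiff ℝ 1 v →
      ∫⁻ x in unitCube (0 : Fin N → ℤ), ‖w x‖ₑ ^ 2 * ‖v x‖ₑ ^ 2 ≤
        C * eLpNorm w r (volume.restrict (unitCube (0 : Fin N → ℤ))) ^ 2 *
          ∫⁻ x in Metric.closedBall (0 : Space N) (N + 2 : ℕ), (‖v x‖ₑ ^ 2 + ‖gradNorm v x‖ₑ ^ 2) := by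
  obtain ⟨χ, M, hχ, hχs, hχ1, hχn, hM⟩ := exists_cutoff_unitCube N
  obtain ⟨C, hC⟩ := hq (Metric.closedBall (0 : Space N) (N + 2 : ℕ)) Metric.isBounded_closedBall
  refine ⟨C ^ 2 * (2 * (M ^ 2 + 1)), fun w v hw hv => ?_⟩
  set Q := unitCube (0 : Fin N → ℤ) with hQ
  set B := Metric.closedBall (0 : Space N) (N + 2 : ℕ) with hB
  have hf : ContDiff ℝ 1 (fun x => χ x • v x) := hχ.smul hv
  have hsupp : Function.support (fun x => χ x • v x) ⊆ B := fun x hx =>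
    hχs fun h => hx (by simp [h])
  have hD : ∀ x, ‖gradNorm (fun x => χ x • v x) x‖ₑ ^ 2 ≤
      2 * (M ^ 2 + 1) * (‖v x‖ₑ ^ 2 + ‖gradNorm v x‖ₑ ^ 2) := fun x =>
    enorm_fderiv_smul_sq_le (hχ.differentiable one_ne_zero x)
      (hv.differentiable one_ne_zero x) (hχn x) (hM x)
  have hDs : Function.support (fun x => ‖gradNorm (fun x => χ x • v x) x‖ₑ ^ 2) ⊆ B := by
    intro x hx
    refine closure_minimal hsupp Metric.isClosed_closedBall (support_gradNorm_subset _ ?_)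
    intro h
    refine hx ?_
    simp only [h, enorm_zero]
    norm_num
  have hgrad : eLpNorm (gradNorm fun x => χ x • v x) 2 volume ^ 2 ≤
      2 * (M ^ 2 + 1) * ∫⁻ x in B, (‖v x‖ₑ ^ 2 + ‖gradNorm v x‖ₑ ^ 2) := by
    rw [eLpNorm_two_sq, ← setLIntegral_eq_of_support_subset hDs,
      ← lintegral_const_mul' _ _ (by finiteness)]
    exact lintegral_mono fun x => hD x
  have hhol : eLpNorm (fun x => w x • (χ x • v x)) 2 (volume.restrict Q) ≤
      eLpNorm w r (volume.restrict Q) * eLpNorm (fun x => χ x • v x) q (volume.restrict Q) :=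
    eLpNorm_real_smul_le hw hf.continuous.aestronglyMeasurable
  calc ∫⁻ x in Q, ‖w x‖ₑ ^ 2 * ‖v x‖ₑ ^ 2
      = eLpNorm (fun x => w x • (χ x • v x)) 2 (volume.restrict Q) ^ 2 := by
        rw [eLpNorm_two_sq]
        refine setLIntegral_congr_fun (measurableSet_unitCube _) fun x hx => ?_
        rw [hχ1 x hx, one_smul, enorm_smul, mul_pow]
    _ ≤ (eLpNorm w r (volume.restrict Q) *
          (C * eLpNorm (gradNorm fun x => χ x • v x) 2 volume)) ^ 2 := by
        gcongr
        refine hhol.trans ?_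
        gcongr
        exact (eLpNorm_mono_measure _ Measure.restrict_le_self).trans (hC _ hf hsupp)
    _ = C ^ 2 * eLpNorm w r (volume.restrict Q) ^ 2 *
          eLpNorm (gradNorm fun x => χ x • v x) 2 volume ^ 2 := by ring
    _ ≤ C ^ 2 * eLpNorm w r (volume.restrict Q) ^ 2 *
          (2 * (M ^ 2 + 1) * ∫⁻ x in B, (‖v x‖ₑ ^ 2 + ‖gradNorm v x‖ₑ ^ 2)) := by gcongr
    _ = _ := by push_cast; ring

/-- `w` is a multiplier of `H¹`, tested on functions of class `C¹`. -/
def IsSobolevWeight {N : ℕ} (w : Space N → ℝ) : Prop :=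
  AEStronglyMeasurable w volume ∧ ∃ C : ℝ≥0, ∀ v : Space N → ℂ, ContDiff ℝ 1 v →
    ∫⁻ x, ‖w x‖ₑ ^ 2 * ‖v x‖ₑ ^ 2 ≤ C * ∫⁻ x, (‖v x‖ₑ ^ 2 + ‖gradNorm v x‖ₑ ^ 2)

/-- The estimate on the cube at the origin is translated to every lattice cube, with `S` bounding
all the norms of `w`. Summing costs the factor `(2(N + 2) + 3)^N`, the overlap bound for balls of
radius `N + 2`. -/
theorem isSobolevWeight_of_localSobolev {N : ℕ} {q r : ℝ≥0∞} [ENNReal.HolderTriple r q 2]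
    (hq : LocalSobolev N q) {w : Space N → ℝ} (hw : AEStronglyMeasurable w volume)
    (hb : (⨆ k : Fin N → ℤ, eLpNorm w r (volume.restrict (unitCube k))) < ⊤) :
    IsSobolevWeight w := by
  obtain ⟨C, hC⟩ := setLIntegral_unitCube_zero_le (r := r) hq
  lift (⨆ k : Fin N → ℤ, eLpNorm w r (volume.restrict (unitCube k))) to ℝ≥0 using hb.ne
    with S hS
  refine ⟨hw, C * S ^ 2 * ((2 * (N + 2) + 3) ^ N : ℕ), fun v hv => ?_⟩
  set F : Space N → ℝ≥0∞ := fun x => ‖v x‖ₑ ^ 2 + ‖gradNorm v x‖ₑ ^ 2 with hF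
  have hFm : Measurable F := by
    have h1 := hv.continuous
    have h2 := continuous_gradNorm hv
    exact (by fun_prop : Continuous F).measurable
  have key : ∀ k : Fin N → ℤ, ∫⁻ x in unitCube k, ‖w x‖ₑ ^ 2 * ‖v x‖ₑ ^ 2 ≤
      C * S ^ 2 * ∫⁻ x in Metric.closedBall (latticePoint k) (N + 2 : ℕ), F x := by
    intro k
    have hmp := measurePreserving_add_right (volume : Measure (Space N)) (latticePoint k)
    have hemb := measurableEmbedding_addRight (latticePoint k)
    have hmpQ : MeasurePreserving (fun x => x + latticePoint k)
        (volume.restrict (unitCube (0 : Fin N → ℤ))) (volume.restrict (unitCube k)) := by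
      rw [← preimage_add_unitCube k]
      exact hmp.restrict_preimage (measurableSet_unitCube k)
    have h1 := hC (fun x => w (x + latticePoint k)) (fun x => v (x + latticePoint k))
      (hw.restrict.comp_measurePreserving hmpQ) (hv.comp (contDiff_id.add contDiff_const))
    have h2 : eLpNorm (fun x => w (x + latticePoint k)) r
        (volume.restrict (unitCube (0 : Fin N → ℤ))) ≤ S := by
      have h3 := eLpNorm_comp_measurePreserving (p := r) hw.restrict hmpQ
      rw [hS, Function.comp_def] at *
      rw [h3]
      exact le_iSup (fun k : Fin N → ℤ => eLpNorm w r (volume.restrict (unitCube k))) k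
    have h4 : ∫⁻ x in unitCube k, ‖w x‖ₑ ^ 2 * ‖v x‖ₑ ^ 2 =
        ∫⁻ x in unitCube (0 : Fin N → ℤ),
          ‖w (x + latticePoint k)‖ₑ ^ 2 * ‖v (x + latticePoint k)‖ₑ ^ 2 := by
      rw [← preimage_add_unitCube k]
      exact (hmp.setLIntegral_comp_preimage_emb hemb
        (fun x => ‖w x‖ₑ ^ 2 * ‖v x‖ₑ ^ 2) _).symm
    have h5 : ∫⁻ x in Metric.closedBall (latticePoint k) (N + 2 : ℕ), F x =
        ∫⁻ x in Metric.closedBall (0 : Space N) (N + 2 : ℕ), F (x + latticePoint k) := by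
      rw [← hmp.setLIntegral_comp_preimage_emb hemb]
      congr 2
      ext x
      simp
    have h6 : ∀ x, gradNorm (fun x => v (x + latticePoint k)) x
        = gradNorm v (x + latticePoint k) := fun x => by rw [gradNorm, fderiv_comp_add_right, gradNorm]
    simp only [h6] at h1
    rw [h4, h5]
    refine h1.trans ?_
    gcongr
  calc ∫⁻ x, ‖w x‖ₑ ^ 2 * ‖v x‖ₑ ^ 2
      ≤ ∑' k : Fin N → ℤ, ∫⁻ x in unitCube k, ‖w x‖ₑ ^ 2 * ‖v x‖ₑ ^ 2 :=
        lintegral_le_tsum_unitCube _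
    _ ≤ ∑' k : Fin N → ℤ, C * S ^ 2 *
          ∫⁻ x in Metric.closedBall (latticePoint k) (N + 2 : ℕ), F x := ENNReal.tsum_le_tsum key
    _ = C * S ^ 2 * ∑' k : Fin N → ℤ,
          ∫⁻ x in Metric.closedBall (latticePoint k) (N + 2 : ℕ), F x := ENNReal.tsum_mul_left
    _ ≤ C * S ^ 2 * (((2 * (N + 2) + 3) ^ N : ℕ) * ∫⁻ x, F x) := by
        gcongr
        exact tsum_lintegral_closedBall_le _ _ hFm
    _ = _ := by push_cast; ring

/-! ### Mollification and passage to weak derivatives -/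

/-- A form of Scheffé's lemma: `|f n - g| - |f n| + |g|` is dominated by `2|g|` and tends to zero,
while its integral is at least `∫ |f n - g|` because `∫ |f n| ≤ ∫ |g|`. -/
theorem tendsto_lintegral_enorm_sub_of_ae_tendsto {α : Type*} [MeasurableSpace α] {μ : Measure α}
    {f : ℕ → α → ℂ} {g : α → ℂ} (hf : ∀ n, AEStronglyMeasurable (f n) μ) (hg : Integrable g μ)
    (hlim : ∀ᵐ x ∂μ, Tendsto (fun n => f n x) atTop (𝓝 (g x)))
    (hle : ∀ n, ∫⁻ x, ‖f n x‖ₑ ∂μ ≤ ∫⁻ x, ‖g x‖ₑ ∂μ) :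
    Tendsto (fun n => ∫⁻ x, ‖f n x - g x‖ₑ ∂μ) atTop (𝓝 0) := by
  have hfi : ∀ n, Integrable (f n) μ := fun n => ⟨hf n, (hle n).trans_lt hg.2⟩
  have hnorm : ∀ n, ∫ x, ‖f n x‖ ∂μ ≤ ∫ x, ‖g x‖ ∂μ := by
    intro n
    rw [integral_norm_eq_lintegral_enorm (hf n), integral_norm_eq_lintegral_enorm hg.1]
    exact ENNReal.toReal_mono hg.2.ne (hle n)
  have h1 : Tendsto (fun n => ∫ x, (‖f n x - g x‖ - ‖f n x‖ + ‖g x‖) ∂μ) atTop (𝓝 0) := by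
    have h2 := tendsto_integral_of_dominated_convergence (μ := μ)
      (F := fun n x => ‖f n x - g x‖ - ‖f n x‖ + ‖g x‖) (f := fun _ => (0 : ℝ))
      (fun x => 2 * ‖g x‖)
      (fun n => ((((hfi n).sub hg).norm.sub (hfi n).norm).add hg.norm).1) (hg.norm.const_mul 2)
      (fun n => Eventually.of_forall fun x => by
        have h3 := norm_sub_le (f n x) (g x)
        have h4 := norm_sub_norm_le (f n x) (g x)
        rw [Real.norm_eq_abs, abs_le]
        constructor <;> linarith [norm_nonneg (g x)])
      (by
        filter_upwards [hlim] with x hx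
        have h5 := ((hx.sub_const (g x)).norm.sub hx.norm).add_const ‖g x‖
        simpa using h5)
    simpa using h2
  have h6 : Tendsto (fun n => ∫ x, ‖f n x - g x‖ ∂μ) atTop (𝓝 0) := by
    refine squeeze_zero (fun n => integral_nonneg fun x => norm_nonneg _) (fun n => ?_) h1
    have h7 := ((hfi n).sub hg).norm
    have h9 : ∫ x, (‖f n x - g x‖ - ‖f n x‖ + ‖g x‖) ∂μ =
        ∫ x, ‖f n x - g x‖ ∂μ - ∫ x, ‖f n x‖ ∂μ + ∫ x, ‖g x‖ ∂μ :=
      (integral_add (h7.sub (hfi n).norm) hg.norm).trans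
        (congrArg (· + _) (integral_sub h7 (hfi n).norm))
    rw [h9]
    linarith [hnorm n]
  have h8 : ∀ n, ∫⁻ x, ‖f n x - g x‖ₑ ∂μ = ENNReal.ofReal (∫ x, ‖f n x - g x‖ ∂μ) := fun n =>
    (ofReal_integral_norm_eq_lintegral_enorm ((hfi n).sub hg)).symm
  simp_rw [h8]
  simpa using ENNReal.tendsto_ofReal h6

/-- `h = ∂_j u` in the sense of distributions. -/
def HasWeakPartial {N : ℕ} (j : Fin N) (u h : Space N → ℂ) : Prop :=
  ∀ φ : Space N → ℂ, IsTestFunction φ → ∫ x, h x * φ x = -∫ x, u x * partialDeriv j φ x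

/-- The bump functions of the standard mollifiers. -/
def mollifierBump (N n : ℕ) : ContDiffBump (0 : Space N) where
  rIn := 1 / (n + 1)
  rOut := 2 / (n + 1)
  rIn_pos := by positivity
  rIn_lt_rOut := by gcongr; norm_num

/-- A sequence of smooth mollifiers. -/
def mollifier (N n : ℕ) : Space N → ℝ := (mollifierBump N n).normed volume

/-- Convolution with the mollifiers. -/
def mollify {N : ℕ} (n : ℕ) (u : Space N → ℂ) : Space N → ℂ :=
  mollifier N n ⋆[ContinuousLinearMap.lsmul ℝ ℝ, volume] u

theorem contDiff_mollifier (N n : ℕ) : ContDiff ℝ ∞ (mollifier N n) :=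
  (mollifierBump N n).contDiff_normed

theorem hasCompactSupport_mollifier (N n : ℕ) : HasCompactSupport (mollifier N n) :=
  (mollifierBump N n).hasCompactSupport_normed

theorem lintegral_enorm_mollifier (N n : ℕ) : ∫⁻ t, ‖mollifier N n t‖ₑ = 1 := by
  have h1 : Integrable (mollifier N n) :=
    (contDiff_mollifier N n).continuous.integrable_of_hasCompactSupport
      (hasCompactSupport_mollifier N n)
  rw [← ofReal_integral_norm_eq_lintegral_enorm h1]
  have h2 : ∀ t, ‖mollifier N n t‖ = mollifier N n t := fun t =>
    Real.norm_of_nonneg ((mollifierBump N n).nonneg_normed t)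
  simp_rw [h2]
  rw [mollifier, ContDiffBump.integral_normed]
  simp

theorem mollifier_eq_zero {N n : ℕ} {t : Space N} (ht : 2 < ‖t‖) : mollifier N n t = 0 := by
  by_contra h
  have h1 : t ∈ Function.support ((mollifierBump N n).normed volume) := h
  rw [ContDiffBump.support_normed_eq, mem_ball_zero_iff] at h1
  have h2 : (mollifierBump N n).rOut ≤ 2 := by
    simp only [mollifierBump]
    rw [div_le_iff₀ (by positivity)]
    have : (0 : ℝ) ≤ n := by positivity
    linarith
  linarith

theorem contDiff_mollify {N : ℕ} (n : ℕ) {u : Space N → ℂ} (hu : LocallyIntegrable u) :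
    ContDiff ℝ ∞ (mollify n u) :=
  (hasCompactSupport_mollifier N n).contDiff_convolution_left _ (contDiff_mollifier N n) hu

theorem ae_tendsto_mollify {N : ℕ} {u : Space N → ℂ} (hu : LocallyIntegrable u) :
    ∀ᵐ x, Tendsto (fun n => mollify n u x) atTop (𝓝 (u x)) := by
  refine ContDiffBump.ae_convolution_tendsto_right_of_locallyIntegrable
    (φ := mollifierBump N) (K := 2) ?_ ?_ hu
  · have h := (tendsto_one_div_add_atTop_nhds_zero_nat (𝕜 := ℝ)).const_mul 2
    simp only [mul_zero] at h
    refine h.congr fun n => ?_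
    simp only [mollifierBump]
    ring
  · refine Eventually.of_forall fun n => ?_
    simp only [mollifierBump]
    apply le_of_eq
    ring

/-- The derivative falls on the kernel, and `t ↦ η(x - t)` is a test function for the weak
derivative. The sign from differentiating in `t` instead of `x` cancels the one from integration by
parts. -/
theorem partialDeriv_mollify {N : ℕ} (n : ℕ) {j : Fin N} {u h : Space N → ℂ}
    (hu : LocallyIntegrable u) (hj : HasWeakPartial j u h) (x : Space N) :
    partialDeriv j (mollify n u) x = mollify n h x := by
  have hη := contDiff_mollifier N n
  have hc := hasCompactSupport_mollifier N n
  have hη1 : ContDiff ℝ 1 (mollifier N n) := hη.of_le (by norm_cast)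
  have hflip : mollify n u =
      u ⋆[(ContinuousLinearMap.lsmul ℝ ℝ : ℝ →L[ℝ] ℂ →L[ℝ] ℂ).flip, volume] mollifier N n :=
    (convolution_flip _).symm
  have hder := hc.hasFDerivAt_convolution_right
    ((ContinuousLinearMap.lsmul ℝ ℝ : ℝ →L[ℝ] ℂ →L[ℝ] ℂ).flip) hu hη1 x
  rw [partialDeriv, hflip, hder.fderiv,
    convolution_precompR_apply _ hu (hc.fderiv ℝ) (hη1.continuous_fderiv one_ne_zero)]
  set φ : Space N → ℂ := fun t => (mollifier N n (x - t) : ℂ) with hφ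
  have hsub : ContDiff ℝ ∞ (fun t : Space N => x - t) := contDiff_const.sub contDiff_id
  have htest : IsTestFunction φ := by
    refine ⟨Complex.ofRealCLM.contDiff.comp (hη.comp hsub), ?_⟩
    have h1 : HasCompactSupport (fun t => mollifier N n (x - t)) :=
      hc.comp_homeomorph (Homeomorph.subLeft x)
    exact h1.comp_left (g := Complex.ofReal) (by simp)
  have hpd : ∀ t, partialDeriv j φ t =
      -((fderiv ℝ (mollifier N n) (x - t) (EuclideanSpace.single j 1) : ℝ) : ℂ) := by
    intro t
    have h1 : HasFDerivAt (fun t : Space N => x - t) (-ContinuousLinearMap.id ℝ (Space N)) t := by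
      simpa using (hasFDerivAt_id t).const_sub x
    have h2 := ((hη1.differentiable one_ne_zero (x - t)).hasFDerivAt.comp t h1)
    have h3 := (Complex.ofRealCLM.hasFDerivAt (x := mollifier N n (x - t))).comp t h2
    have h4 : HasFDerivAt φ _ t := h3
    rw [partialDeriv, h4.fderiv]
    simp
  have h5 := hj φ htest
  simp only [hpd] at h5
  have h6 : mollify n h x = ∫ t, h t * φ t := by
    rw [mollify, convolution_lsmul_swap]
    refine integral_congr_ae (Eventually.of_forall fun t => ?_)
    simp only [hφ, Complex.real_smul, mul_comm]
  rw [h6, h5, convolution_def, ← integral_neg]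
  refine integral_congr_ae (Eventually.of_forall fun t => ?_)
  simp only [ContinuousLinearMap.flip_apply, ContinuousLinearMap.lsmul_apply, Complex.real_smul]
  ring

theorem enorm_mollify_le {N : ℕ} (n : ℕ) (u : Space N → ℂ) (x : Space N) :
    ‖mollify n u x‖ₑ ≤ ∫⁻ t, ‖mollifier N n t‖ₑ * ‖u (x - t)‖ₑ := by
  rw [mollify, convolution_lsmul]
  refine (enorm_integral_le_lintegral_enorm _).trans (le_of_eq ?_)
  simp_rw [enorm_smul]

theorem lintegral_lintegral_mollifier_mul {N : ℕ} (n : ℕ) {g : Space N → ℝ≥0∞}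
    (hg : AEMeasurable g) :
    ∫⁻ x, ∫⁻ t, ‖mollifier N n t‖ₑ * g (x - t) = ∫⁻ x, g x := by
  have hm : Measurable fun t => ‖mollifier N n t‖ₑ :=
    (contDiff_mollifier N n).continuous.enorm.measurable
  have h1 : AEMeasurable (fun p : Space N × Space N => g (p.1 - p.2)) (volume.prod volume) :=
    hg.comp_quasiMeasurePreserving
      (quasiMeasurePreserving_sub_of_right_invariant volume volume)
  rw [lintegral_lintegral_swap ((hm.comp measurable_snd).aemeasurable.mul h1)]
  have h2 : ∀ t, ∫⁻ x, ‖mollifier N n t‖ₑ * g (x - t) = ‖mollifier N n t‖ₑ * ∫⁻ x, g x := by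
    intro t
    rw [lintegral_const_mul' _ _ enorm_ne_top, lintegral_sub_right_eq_self]
  simp_rw [h2]
  rw [lintegral_mul_const _ hm, lintegral_enorm_mollifier, one_mul]

theorem lintegral_enorm_mollify_le {N : ℕ} (n : ℕ) {u : Space N → ℂ}
    (hu : AEStronglyMeasurable u) : ∫⁻ x, ‖mollify n u x‖ₑ ≤ ∫⁻ x, ‖u x‖ₑ :=
  (lintegral_mono fun x => enorm_mollify_le n u x).trans
    (lintegral_lintegral_mollifier_mul n hu.enorm).le

/-- Pointwise, `|η * u|²` is at most `η * |u|²`: the `L¹` norm is at most the `L²` norm for the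
probability measure `η(t) dt`. Tonelli then gives the integrated bound. -/
theorem lintegral_enorm_mollify_sq_le {N : ℕ} (n : ℕ) {u : Space N → ℂ}
    (hu : AEStronglyMeasurable u) : ∫⁻ x, ‖mollify n u x‖ₑ ^ 2 ≤ ∫⁻ x, ‖u x‖ₑ ^ 2 := by
  have hm : Measurable fun t => ‖mollifier N n t‖ₑ :=
    (contDiff_mollifier N n).continuous.enorm.measurable
  rw [← lintegral_lintegral_mollifier_mul n (hu.enorm.pow_const 2)]
  refine lintegral_mono fun x => ?_
  set ν : Measure (Space N) := volume.withDensity fun t => ‖mollifier N n t‖ₑ with hν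
  have hprob : IsProbabilityMeasure ν :=
    ⟨by rw [hν, withDensity_apply _ MeasurableSet.univ, Measure.restrict_univ,
      lintegral_enorm_mollifier]⟩
  have hux : AEStronglyMeasurable (fun t => u (x - t)) volume :=
    hu.comp_quasiMeasurePreserving (quasiMeasurePreserving_sub_left_of_right_invariant volume x)
  have h1 := eLpNorm_le_eLpNorm_of_exponent_le (μ := ν) (p := 1) (q := 2) (by norm_num)
    (hux.mono_ac (withDensity_absolutelyContinuous _ _))
  have h2 : ∀ g : Space N → ℝ≥0∞, ∫⁻ t, g t ∂ν = ∫⁻ t, ‖mollifier N n t‖ₑ * g t := fun g => by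
    rw [hν, lintegral_withDensity_eq_lintegral_mul_non_measurable _ hm
      (Eventually.of_forall fun t => enorm_lt_top)]
    rfl
  calc ‖mollify n u x‖ₑ ^ 2 ≤ (∫⁻ t, ‖mollifier N n t‖ₑ * ‖u (x - t)‖ₑ) ^ 2 := by
        gcongr
        exact enorm_mollify_le n u x
    _ ≤ eLpNorm (fun t => u (x - t)) 2 ν ^ 2 := by
        rw [eLpNorm_one_eq_lintegral_enorm, h2] at h1
        gcongr
    _ = _ := by rw [eLpNorm_two_sq, h2]

theorem tendsto_lintegral_enorm_mollify_sub {N : ℕ} {u : Space N → ℂ} (hu : LocallyIntegrable u)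
    {K : Set (Space N)} (hK : IsCompact K) :
    Tendsto (fun n => ∫⁻ x in K, ‖mollify n u x - u x‖ₑ) atTop (𝓝 0) := by
  -- All kernels are supported in the ball of radius `2`, so on `K` only the values of `u` on `K'`
  -- matter. Cutting off there makes `u` globally integrable.
  set K' := Metric.cthickening 2 K with hK'
  have hK'c : IsCompact K' := hK.cthickening
  have hi : Integrable (K'.indicator u) :=
    (integrable_indicator_iff hK'c.measurableSet).2 (hu.integrableOn_isCompact hK'c)
  have h1 := tendsto_lintegral_enorm_sub_of_ae_tendsto (μ := (volume : Measure (Space N)))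
    (f := fun n => mollify n (K'.indicator u)) (g := K'.indicator u)
    (fun n => (contDiff_mollify n hi.locallyIntegrable).continuous.aestronglyMeasurable) hi
    (ae_tendsto_mollify hi.locallyIntegrable)
    (fun n => lintegral_enorm_mollify_le n hi.1)
  refine tendsto_of_tendsto_of_tendsto_of_le_of_le tendsto_const_nhds h1 (fun n => zero_le)
    fun n => ?_
  refine le_trans (le_of_eq ?_) (setLIntegral_le_lintegral K _)
  refine setLIntegral_congr_fun hK.measurableSet fun x hx => ?_
  have hxK' : x ∈ K' := Metric.self_subset_cthickening K hx
  have h2 : mollify n u x = mollify n (K'.indicator u) x := by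
    rw [mollify, mollify, convolution_lsmul, convolution_lsmul]
    refine integral_congr_ae (Eventually.of_forall fun t => ?_)
    rcases le_or_gt ‖t‖ 2 with ht | ht
    · have : x - t ∈ K' := by
        refine Metric.mem_cthickening_of_dist_le (x - t) x 2 K hx ?_
        simpa [dist_eq_norm] using ht
      simp only [Set.indicator_of_mem this]
    · simp only [mollifier_eq_zero ht, zero_smul]
  simp only [h2, Set.indicator_of_mem hxK']

theorem enorm_gradNorm_sq_le {N : ℕ} (v : Space N → ℂ) (x : Space N) :
    ‖gradNorm v x‖ₑ ^ 2 ≤ N * ∑ j, ‖partialDeriv j v x‖ₑ ^ 2 := by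
  have h1 : gradNorm v x ≤ ∑ j, ‖partialDeriv j v x‖ := by
    refine ContinuousLinearMap.opNorm_le_bound _ (Finset.sum_nonneg fun _ _ => norm_nonneg _)
      fun y => ?_
    have hy : y = ∑ j, y j • EuclideanSpace.single j (1 : ℝ) := by
      ext i
      simp [Finset.sum_apply, Pi.single_apply]
    conv_lhs => rw [hy]
    rw [map_sum, Finset.sum_mul]
    refine (norm_sum_le _ _).trans (Finset.sum_le_sum fun j _ => ?_)
    rw [map_smul, norm_smul, mul_comm, partialDeriv]
    gcongr
    exact PiLp.norm_apply_le y j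
  have h2 : gradNorm v x ^ 2 ≤ N * ∑ j, ‖partialDeriv j v x‖ ^ 2 := by
    refine (pow_le_pow_left₀ (norm_nonneg _) h1 2).trans ?_
    simpa using sq_sum_le_card_mul_sum_sq (s := Finset.univ)
      (f := fun j => ‖partialDeriv j v x‖)
  have h3 : ‖gradNorm v x‖₊ ^ 2 ≤ N * ∑ j, ‖partialDeriv j v x‖₊ ^ 2 := by
    rw [← NNReal.coe_le_coe]
    push_cast
    rw [Real.norm_eq_abs, sq_abs]
    exact h2
  simp only [enorm_eq_nnnorm]
  exact_mod_cast h3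

/-- The weighted estimate, for weakly differentiable functions. -/
theorem IsSobolevWeight.lintegral_le {N : ℕ} {w : Space N → ℝ} (hw : IsSobolevWeight w) :
    ∃ C : ℝ≥0, ∀ (v : Space N → ℂ) (g : Fin N → Space N → ℂ), LocallyIntegrable v →
      (∀ j, AEStronglyMeasurable (g j)) → (∀ j, HasWeakPartial j v (g j)) →
      ∫⁻ x, ‖w x‖ₑ ^ 2 * ‖v x‖ₑ ^ 2 ≤ C * ((∫⁻ x, ‖v x‖ₑ ^ 2) + ∑ j, ∫⁻ x, ‖g j x‖ₑ ^ 2) := by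
  obtain ⟨hwm, C, hC⟩ := hw
  refine ⟨C * (N + 1), fun v g hv hg hvg => ?_⟩
  -- A bound uniform in `n`: mollification commutes with weak derivatives and does not increase `L²`
  -- norms. The factor `N + 1` absorbs the passage from the operator norm of the derivative to the
  -- partial derivatives.
  have hn : ∀ n, ∫⁻ x, ‖w x‖ₑ ^ 2 * ‖mollify n v x‖ₑ ^ 2 ≤
      C * (N + 1) * ((∫⁻ x, ‖v x‖ₑ ^ 2) + ∑ j, ∫⁻ x, ‖g j x‖ₑ ^ 2) := by
    intro n
    have hcd := contDiff_mollify n hv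
    have hcd1 : ContDiff ℝ 1 (mollify n v) := hcd.of_le (by norm_cast)
    have hpm : ∀ j, Measurable fun x => ‖partialDeriv j (mollify n v) x‖ₑ ^ 2 := fun j =>
      (((hcd1.continuous_fderiv one_ne_zero).clm_apply continuous_const).enorm.measurable.pow_const 2)
    calc ∫⁻ x, ‖w x‖ₑ ^ 2 * ‖mollify n v x‖ₑ ^ 2
        ≤ C * ∫⁻ x, (‖mollify n v x‖ₑ ^ 2 + ‖gradNorm (mollify n v) x‖ₑ ^ 2) := hC _ hcd1
      _ ≤ C * ∫⁻ x, (‖mollify n v x‖ₑ ^ 2 + N * ∑ j, ‖partialDeriv j (mollify n v) x‖ₑ ^ 2) := by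
          gcongr
          exact enorm_gradNorm_sq_le _ _
      _ = C * ((∫⁻ x, ‖mollify n v x‖ₑ ^ 2) +
            N * ∑ j, ∫⁻ x, ‖partialDeriv j (mollify n v) x‖ₑ ^ 2) := by
          rw [lintegral_add_left (hcd.continuous.enorm.measurable.pow_const 2),
            lintegral_const_mul' _ _ (by finiteness), lintegral_finsetSum _ fun j _ => hpm j]
      _ ≤ C * ((∫⁻ x, ‖v x‖ₑ ^ 2) + N * ∑ j, ∫⁻ x, ‖g j x‖ₑ ^ 2) := by
          refine mul_le_mul_right (add_le_add
            (lintegral_enorm_mollify_sq_le n hv.aestronglyMeasurable)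
            (mul_le_mul_right (Finset.sum_le_sum fun j _ => ?_) _)) _
          simp_rw [partialDeriv_mollify n hv (hvg j)]
          exact lintegral_enorm_mollify_sq_le n (hg j)
      _ ≤ C * ((N + 1) * (∫⁻ x, ‖v x‖ₑ ^ 2) + (N + 1) * ∑ j, ∫⁻ x, ‖g j x‖ₑ ^ 2) := by
          gcongr
          · exact le_mul_of_one_le_left (zero_le) le_add_self
          · exact le_self_add
      _ = _ := by ring
  -- Fatou needs only almost everywhere convergence of the mollifications, so `w v ∈ L²` need not be
  -- known beforehand.
  have hlim : ∀ᵐ x, ‖w x‖ₑ ^ 2 * ‖v x‖ₑ ^ 2 ≤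
      liminf (fun n => ‖w x‖ₑ ^ 2 * ‖mollify n v x‖ₑ ^ 2) atTop := by
    filter_upwards [ae_tendsto_mollify hv] with x hx
    exact (ENNReal.Tendsto.const_mul (ENNReal.Tendsto.pow hx.enorm) (Or.inr (by finiteness))).liminf_eq.ge
  refine (lintegral_mono_ae hlim).trans ?_
  refine (lintegral_liminf_le' fun n => (hwm.enorm.pow_const 2).mul
    ((contDiff_mollify n hv).continuous.enorm.measurable.pow_const 2).aemeasurable).trans ?_
  refine (liminf_le_liminf (Eventually.of_forall hn)).trans ?_
  rw [liminf_const]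
  push_cast
  rfl

/-! ### Regularized modulus and the diamagnetic argument -/

/-- The regularized modulus `√(|z|² + ε²) - ε`. -/
def regAbs (ε : ℝ) (z : ℂ) : ℝ := √(‖z‖ ^ 2 + ε ^ 2) - ε

/-- The derivative of the regularized modulus, as a complex number. -/
def regSign (ε : ℝ) (z : ℂ) : ℂ := conj z / (√(‖z‖ ^ 2 + ε ^ 2) : ℝ)

theorem continuous_regAbs (ε : ℝ) : Continuous (regAbs ε) := by
  unfold regAbs
  fun_prop

theorem sqrt_add_sq_pos {ε : ℝ} (hε : 0 < ε) (z : ℂ) : 0 < √(‖z‖ ^ 2 + ε ^ 2) := by positivity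

theorem continuous_regSign {ε : ℝ} (hε : 0 < ε) : Continuous (regSign ε) := by
  unfold regSign
  refine Continuous.div (by fun_prop) (by fun_prop) fun z => ?_
  exact_mod_cast (sqrt_add_sq_pos hε z).ne'

theorem norm_regSign_le {ε : ℝ} (hε : 0 < ε) (z : ℂ) : ‖regSign ε z‖ ≤ 1 := by
  have h := sqrt_add_sq_pos hε z
  rw [regSign, norm_div, RCLike.norm_conj, Complex.norm_real, Real.norm_of_nonneg h.le,
    div_le_one h]
  exact Real.le_sqrt_of_sq_le (by nlinarith [sq_nonneg ε])

theorem abs_regAbs_sub_le (ε : ℝ) (z w : ℂ) : |regAbs ε z - regAbs ε w| ≤ ‖z - w‖ := by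
  have key : ∀ a b : ℝ, √(a ^ 2 + ε ^ 2) ≤ √(b ^ 2 + ε ^ 2) + |a - b| := by
    intro a b
    have hB : |b| ≤ √(b ^ 2 + ε ^ 2) := Real.abs_le_sqrt (by nlinarith [sq_nonneg ε])
    have hB2 : √(b ^ 2 + ε ^ 2) ^ 2 = b ^ 2 + ε ^ 2 := Real.sq_sqrt (by positivity)
    refine Real.sqrt_le_iff.2 ⟨by positivity, ?_⟩
    have h1 : b * (a - b) ≤ √(b ^ 2 + ε ^ 2) * |a - b| :=
      (le_abs_self _).trans (by rw [abs_mul]; gcongr)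
    have h2 : |a - b| ^ 2 = (a - b) ^ 2 := sq_abs _
    nlinarith
  have h1 := key ‖z‖ ‖w‖
  have h2 := key ‖w‖ ‖z‖
  have h3 := abs_norm_sub_norm_le z w
  rw [abs_sub_comm ‖w‖] at h2
  rw [regAbs, regAbs, abs_le]
  constructor <;> linarith

/-- `regAbs` is 1-Lipschitz and vanishes at the origin; this is why `ε` is subtracted from the
square root. -/
theorem abs_regAbs_le {ε : ℝ} (hε : 0 < ε) (z : ℂ) : |regAbs ε z| ≤ ‖z‖ := by
  have h := abs_regAbs_sub_le ε z 0
  have h0 : regAbs ε 0 = 0 := by simp [regAbs, Real.sqrt_sq hε.le]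
  simpa [h0] using h

/-- As `ε > 0` keeps the radicand positive, zeros of `u` need no separate treatment. The formula
comes from `∂|u|² = 2 Re(ū ∂u)`. -/
theorem differentiableAt_regAbs_comp {N : ℕ} {ε : ℝ} (hε : 0 < ε) {u : Space N → ℂ} {x : Space N}
    (hu : DifferentiableAt ℝ u x) :
    DifferentiableAt ℝ (fun x => (regAbs ε (u x) : ℂ)) x ∧ ∀ j : Fin N,
      partialDeriv j (fun x => (regAbs ε (u x) : ℂ)) x =
        ((regSign ε (u x) * partialDeriv j u x).re : ℝ) := by
  have hS := sqrt_add_sq_pos hε (u x)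
  have h1 := ((hu.hasFDerivAt.norm_sq.add_const (ε ^ 2)).sqrt
    (by have := hε; positivity)).sub_const ε
  have h2 : HasFDerivAt (fun x => (regAbs ε (u x) : ℂ)) _ x :=
    (Complex.ofRealCLM.hasFDerivAt (x := regAbs ε (u x))).comp x h1
  refine ⟨h2.differentiableAt, fun j => ?_⟩
  rw [partialDeriv, h2.fderiv]
  simp only [ContinuousLinearMap.comp_apply, Complex.ofRealCLM_apply,
    smul_apply, innerSL_apply_apply, Complex.inner, smul_eq_mul, nsmul_eq_mul]
  congr 1
  have h3 : regSign ε (u x) * partialDeriv j u x =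
      partialDeriv j u x * conj (u x) / (√(‖u x‖ ^ 2 + ε ^ 2) : ℝ) := by
    rw [regSign]
    ring
  rw [h3, Complex.div_ofReal_re, partialDeriv]
  push_cast
  field_simp

theorem tendsto_integral_mul_of_tendsto_lintegral {N : ℕ} {f : ℕ → Space N → ℂ}
    {g ψ : Space N → ℂ} (hf : ∀ n, LocallyIntegrable (f n)) (hg : LocallyIntegrable g)
    (hψ : Continuous ψ) (hc : HasCompactSupport ψ)
    (h : Tendsto (fun n => ∫⁻ x in tsupport ψ, ‖f n x - g x‖ₑ) atTop (𝓝 0)) :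
    Tendsto (fun n => ∫ x, f n x * ψ x) atTop (𝓝 (∫ x, g x * ψ x)) := by
  have hint : ∀ {k : Space N → ℂ}, LocallyIntegrable k → Integrable fun x => k x * ψ x := by
    intro k hk
    simpa [mul_comm] using hk.integrable_smul_left_of_hasCompactSupport hψ hc
  obtain ⟨M, hM⟩ := hc.exists_bound_of_continuous hψ
  refine tendsto_integral_of_L1 _ (hint hg).1 (Eventually.of_forall fun n => hint (hf n)) ?_
  have h1 := ENNReal.Tendsto.const_mul (a := ENNReal.ofReal M) h (Or.inr ENNReal.ofReal_ne_top)
  rw [mul_zero] at h1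
  refine tendsto_of_tendsto_of_tendsto_of_le_of_le tendsto_const_nhds h1 (fun n => zero_le)
    fun n => ?_
  have h2 : Function.support (fun x => ‖f n x * ψ x - g x * ψ x‖ₑ) ⊆ tsupport ψ := by
    intro x hx
    refine subset_tsupport ψ fun h => hx ?_
    simp [h]
  simp only
  rw [← setLIntegral_eq_of_support_subset h2, ← lintegral_const_mul' _ _ ENNReal.ofReal_ne_top]
  refine lintegral_mono fun x => ?_
  rw [← sub_mul, enorm_mul, mul_comm]
  gcongr
  rw [← ofReal_norm]
  exact ENNReal.ofReal_le_ofReal (hM x)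

theorem IsTestFunction.partialDeriv {N : ℕ} {φ : Space N → ℂ} (hφ : IsTestFunction φ)
    (j : Fin N) : Continuous (partialDeriv j φ) ∧ HasCompactSupport (partialDeriv j φ) := by
  refine ⟨(hφ.1.continuous_fderiv (by simp)).clm_apply continuous_const, ?_⟩
  exact (hφ.2.fderiv ℝ).comp_left
    (g := fun L : Space N →L[ℝ] ℂ => L (EuclideanSpace.single j 1)) (by simp)

/-- Integration by parts for the regularized modulus of a smooth function. -/
theorem integral_regAbs_of_contDiff {N : ℕ} {ε : ℝ} (hε : 0 < ε) {u : Space N → ℂ}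
    (hu : ContDiff ℝ 1 u) (j : Fin N) {φ : Space N → ℂ} (hφ : IsTestFunction φ) :
    ∫ x, ((regSign ε (u x) * partialDeriv j u x).re : ℂ) * φ x =
      -∫ x, (regAbs ε (u x) : ℂ) * partialDeriv j φ x := by
  have hd := fun x => differentiableAt_regAbs_comp hε (hu.differentiable one_ne_zero x)
  have hpu : Continuous (partialDeriv j u) :=
    (hu.continuous_fderiv one_ne_zero).clm_apply continuous_const
  have hc1 : Continuous fun x => ((regSign ε (u x) * partialDeriv j u x).re : ℂ) :=
    Complex.continuous_ofReal.comp (Complex.continuous_re.comp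
      (((continuous_regSign hε).comp hu.continuous).mul hpu))
  have hc2 : Continuous fun x => (regAbs ε (u x) : ℂ) :=
    Complex.continuous_ofReal.comp ((continuous_regAbs ε).comp hu.continuous)
  have hpφ := hφ.partialDeriv j
  have h1 := integral_mul_fderiv_eq_neg_fderiv_mul_of_integrable
    (μ := (volume : Measure (Space N))) (f := fun x => (regAbs ε (u x) : ℂ)) (g := φ)
    (v := EuclideanSpace.single j 1) ?_ ?_ ?_ (fun x _ => (hd x).1)
    (fun x _ => hφ.1.differentiable (by simp) x)
  · have h2 : ∀ x, fderiv ℝ (fun x => (regAbs ε (u x) : ℂ)) x (EuclideanSpace.single j 1) =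
        ((regSign ε (u x) * partialDeriv j u x).re : ℝ) := fun x => (hd x).2 j
    simp only [h2] at h1
    rw [eq_neg_iff_add_eq_zero, add_comm, ← eq_neg_iff_add_eq_zero]
    exact h1
  · have h2 : ∀ x, fderiv ℝ (fun x => (regAbs ε (u x) : ℂ)) x (EuclideanSpace.single j 1) =
        ((regSign ε (u x) * partialDeriv j u x).re : ℝ) := fun x => (hd x).2 j
    simp only [h2]
    exact (hc1.mul hφ.1.continuous).integrable_of_hasCompactSupport hφ.2.mul_left
  · exact (hc2.mul hpφ.1).integrable_of_hasCompactSupport hpφ.2.mul_left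
  · exact (hc2.mul hφ.1.continuous).integrable_of_hasCompactSupport hφ.2.mul_left

theorem locallyIntegrable_of_norm_le {N : ℕ} {f g : Space N → ℂ} (hg : LocallyIntegrable g)
    (hf : AEStronglyMeasurable f) (h : ∀ x, ‖f x‖ ≤ ‖g x‖) : LocallyIntegrable f :=
  hg.mono hf (Eventually.of_forall h)

theorem norm_re_regSign_mul_le {ε : ℝ} (hε : 0 < ε) (z w : ℂ) :
    ‖((regSign ε z * w).re : ℂ)‖ ≤ ‖w‖ := by
  rw [Complex.norm_real]
  refine (Complex.abs_re_le_norm _).trans ?_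
  rw [norm_mul]
  exact mul_le_of_le_one_left (norm_nonneg _) (norm_regSign_le hε z)

theorem aestronglyMeasurable_re_regSign_mul {N : ℕ} {ε : ℝ} (hε : 0 < ε) {u h : Space N → ℂ}
    (hu : AEStronglyMeasurable u) (hh : AEStronglyMeasurable h) :
    AEStronglyMeasurable fun x => ((regSign ε (u x) * h x).re : ℂ) :=
  (Complex.continuous_ofReal.comp Complex.continuous_re).comp_aestronglyMeasurable
    (((continuous_regSign hε).comp_aestronglyMeasurable hu).mul hh)

/-- The chain rule for the regularized modulus. -/
theorem HasWeakPartial.regAbs {N : ℕ} {ε : ℝ} (hε : 0 < ε) {j : Fin N} {u h : Space N → ℂ}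
    (hu : LocallyIntegrable u) (hh : LocallyIntegrable h) (huh : HasWeakPartial j u h) :
    HasWeakPartial j (fun x => (regAbs ε (u x) : ℂ))
      (fun x => ((regSign ε (u x) * h x).re : ℂ)) := by
  intro φ hφ
  have hmu : ∀ n, ContDiff ℝ 1 (mollify n u) := fun n =>
    (contDiff_mollify n hu).of_le (by norm_cast)
  have hmh : ∀ n, Continuous (mollify n h) := fun n => (contDiff_mollify n hh).continuous
  have hpφ := hφ.partialDeriv j
  have hloc1 : LocallyIntegrable fun x => (MagneticSobolev.regAbs ε (u x) : ℂ) := by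
    refine locallyIntegrable_of_norm_le hu ((Complex.continuous_ofReal.comp
      (continuous_regAbs ε)).comp_aestronglyMeasurable hu.aestronglyMeasurable) fun x => ?_
    rw [Complex.norm_real]
    exact abs_regAbs_le hε _
  have hloc2 : LocallyIntegrable fun x => ((regSign ε (u x) * h x).re : ℂ) :=
    locallyIntegrable_of_norm_le hh (aestronglyMeasurable_re_regSign_mul hε
      hu.aestronglyMeasurable hh.aestronglyMeasurable) fun x => norm_re_regSign_mul_le hε _ _
  have hL1 : Tendsto (fun n => ∫ x, (MagneticSobolev.regAbs ε (mollify n u x) : ℂ) *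
      partialDeriv j φ x) atTop
      (𝓝 (∫ x, (MagneticSobolev.regAbs ε (u x) : ℂ) * partialDeriv j φ x)) := by
    refine tendsto_integral_mul_of_tendsto_lintegral (fun n => Continuous.locallyIntegrable
      (Complex.continuous_ofReal.comp ((continuous_regAbs ε).comp (hmu n).continuous))) hloc1
      hpφ.1 hpφ.2 ?_
    refine tendsto_of_tendsto_of_tendsto_of_le_of_le tendsto_const_nhds
      (tendsto_lintegral_enorm_mollify_sub hu hpφ.2) (fun n => zero_le) fun n => ?_
    refine lintegral_mono fun x => ?_
    rw [enorm_le_iff_norm_le, ← Complex.ofReal_sub, Complex.norm_real]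
    exact abs_regAbs_sub_le ε _ _
  have hL2 : Tendsto (fun n => ∫ x, ((regSign ε (mollify n u x) * mollify n h x).re : ℂ) * φ x)
      atTop (𝓝 (∫ x, ((regSign ε (u x) * h x).re : ℂ) * φ x)) := by
    refine tendsto_integral_mul_of_tendsto_lintegral (fun n => Continuous.locallyIntegrable
      (Complex.continuous_ofReal.comp (Complex.continuous_re.comp
        (((continuous_regSign hε).comp (hmu n).continuous).mul (hmh n))))) hloc2
      hφ.1.continuous hφ.2 ?_
    have hK : IsCompact (tsupport φ) := hφ.2
    have hsm : ∀ n, AEStronglyMeasurable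
        (fun x => regSign ε (mollify n u x) - regSign ε (u x)) volume := fun n =>
      ((continuous_regSign hε).comp (hmu n).continuous).aestronglyMeasurable.sub
        ((continuous_regSign hε).comp_aestronglyMeasurable hu.aestronglyMeasurable)
    -- The signs converge only almost everywhere, but they are bounded by one, so `2|h|` dominates
    -- on the compact support. The other part of the difference is controlled by the `L¹`
    -- convergence of `mollify n h`.
    have hdct : Tendsto (fun n => ∫⁻ x in tsupport φ,
        ‖regSign ε (mollify n u x) - regSign ε (u x)‖ₑ * ‖h x‖ₑ) atTop (𝓝 0) := by
      have h1 := tendsto_lintegral_of_dominated_convergence' (μ := volume.restrict (tsupport φ))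
        (F := fun n x => ‖regSign ε (mollify n u x) - regSign ε (u x)‖ₑ * ‖h x‖ₑ)
        (f := fun _ => 0) (fun x => 2 * ‖h x‖ₑ)
        (fun n => ((hsm n).enorm.mul hh.aestronglyMeasurable.enorm).restrict)
        (fun n => Eventually.of_forall fun x => by
          simp only
          gcongr
          rw [← ofReal_norm]
          refine ENNReal.ofReal_le_of_le_toReal ?_
          have h2 := norm_sub_le (regSign ε (mollify n u x)) (regSign ε (u x))
          have h3 := norm_regSign_le hε (mollify n u x)
          have h4 := norm_regSign_le hε (u x)
          simp only [ENNReal.toReal_ofNat]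
          linarith)
        (by
          rw [lintegral_const_mul' _ _ (by simp)]
          exact ENNReal.mul_ne_top (by simp) (hh.integrableOn_isCompact hK).2.ne)
        (by
          refine ae_restrict_of_ae ?_
          filter_upwards [ae_tendsto_mollify hu] with x hx
          have h5 := ((((continuous_regSign hε).tendsto (u x)).comp hx).sub_const
            (regSign ε (u x))).enorm
          rw [sub_self, enorm_zero] at h5
          have h6 := ENNReal.Tendsto.mul_const (b := ‖h x‖ₑ) h5 (Or.inr enorm_ne_top)
          rwa [zero_mul] at h6)
      simpa using h1
    have hsum := (tendsto_lintegral_enorm_mollify_sub hh hK).add hdct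
    rw [add_zero] at hsum
    refine tendsto_of_tendsto_of_tendsto_of_le_of_le tendsto_const_nhds hsum
      (fun n => zero_le) fun n => ?_
    simp only
    have hm : AEMeasurable (fun x => ‖mollify n h x - h x‖ₑ) (volume.restrict (tsupport φ)) :=
      ((hmh n).aestronglyMeasurable.sub hh.aestronglyMeasurable).enorm.restrict
    rw [← lintegral_add_left' hm]
    refine lintegral_mono fun x => ?_
    have h7 : ‖((regSign ε (mollify n u x) * mollify n h x).re : ℂ) -
        ((regSign ε (u x) * h x).re : ℂ)‖ ≤ ‖mollify n h x - h x‖ +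
          ‖regSign ε (mollify n u x) - regSign ε (u x)‖ * ‖h x‖ := by
      rw [← Complex.ofReal_sub, Complex.norm_real, ← Complex.sub_re]
      refine (Complex.abs_re_le_norm _).trans ?_
      have h8 : regSign ε (mollify n u x) * mollify n h x - regSign ε (u x) * h x =
          regSign ε (mollify n u x) * (mollify n h x - h x) +
            (regSign ε (mollify n u x) - regSign ε (u x)) * h x := by ring
      rw [h8]
      refine (norm_add_le _ _).trans ?_
      rw [norm_mul, norm_mul]
      gcongr
      exact mul_le_of_le_one_left (norm_nonneg _) (norm_regSign_le hε _)
    simp only [enorm_eq_nnnorm]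
    exact_mod_cast h7
  -- For the mollified functions the two sides agree by classical integration by parts.
  refine tendsto_nhds_unique hL2 (hL1.neg.congr fun n => ?_)
  rw [← integral_regAbs_of_contDiff hε (hmu n) j hφ]
  simp_rw [partialDeriv_mollify n hu huh]

/-- The diamagnetic weighted estimate. -/
theorem IsSobolevWeight.lintegral_le_magnetic {N : ℕ} {w : Space N → ℝ}
    (hw : IsSobolevWeight w) :
    ∃ C : ℝ≥0, ∀ (u : Space N → ℂ) (G : Fin N → Space N → ℂ) (B : Space N → Space N),
      LocallyIntegrable u → (∀ j, LocallyIntegrable (G j)) →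
      (∀ j, LocallyIntegrable fun x => (B x j : ℂ) * u x) →
      (∀ j, HasWeakPartial j u fun x => G j x - I * ((B x j : ℂ) * u x)) →
      ∫⁻ x, ‖w x‖ₑ ^ 2 * ‖u x‖ₑ ^ 2 ≤ C * ((∫⁻ x, ‖u x‖ₑ ^ 2) + ∑ j, ∫⁻ x, ‖G j x‖ₑ ^ 2) := by
  obtain ⟨C, hC⟩ := hw.lintegral_le
  refine ⟨C, fun u G B hu hG hBu hw' => ?_⟩
  set ε : ℕ → ℝ := fun n => 1 / (n + 1) with hεdef
  have hε : ∀ n, 0 < ε n := fun n => by simp only [hεdef]; positivity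
  have hε0 : Tendsto ε atTop (𝓝 0) := tendsto_one_div_add_atTop_nhds_zero_nat
  -- The diamagnetic cancellation: `ū · i B u = i B |u|²` is purely imaginary because `B` is real.
  have hgauge : ∀ (n : ℕ) (j : Fin N) (x : Space N),
      (regSign (ε n) (u x) * (G j x - I * ((B x j : ℂ) * u x))).re =
        (regSign (ε n) (u x) * G j x).re := by
    intro n j x
    have h1 : regSign (ε n) (u x) * (I * ((B x j : ℂ) * u x)) =
        ((B x j * ‖u x‖ ^ 2 / √(‖u x‖ ^ 2 + ε n ^ 2) : ℝ) : ℂ) * I := by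
      rw [regSign]
      push_cast
      rw [← Complex.conj_mul']
      ring
    rw [mul_sub, Complex.sub_re, h1, Complex.re_ofReal_mul, Complex.I_re, mul_zero, sub_zero]
  have hmeas : ∀ n, AEStronglyMeasurable (fun x => (regAbs (ε n) (u x) : ℂ)) volume := fun n =>
    (Complex.continuous_ofReal.comp (continuous_regAbs _)).comp_aestronglyMeasurable
      hu.aestronglyMeasurable
  have hnle : ∀ n x, ‖(regAbs (ε n) (u x) : ℂ)‖ ≤ ‖u x‖ := fun n x => by
    rw [Complex.norm_real]
    exact abs_regAbs_le (hε n) _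
  have hn : ∀ n, ∫⁻ x, ‖w x‖ₑ ^ 2 * ‖(regAbs (ε n) (u x) : ℂ)‖ₑ ^ 2 ≤
      C * ((∫⁻ x, ‖u x‖ₑ ^ 2) + ∑ j, ∫⁻ x, ‖G j x‖ₑ ^ 2) := by
    intro n
    refine (hC (fun x => (regAbs (ε n) (u x) : ℂ))
      (fun j x => ((regSign (ε n) (u x) * G j x).re : ℂ))
      (locallyIntegrable_of_norm_le hu (hmeas n) (hnle n))
      (fun j => aestronglyMeasurable_re_regSign_mul (hε n) hu.aestronglyMeasurable
        (hG j).aestronglyMeasurable) fun j => ?_).trans ?_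
    · have hloc : LocallyIntegrable (fun x => G j x - I * ((B x j : ℂ) * u x)) volume :=
        (hG j).sub ((hBu j).smul I)
      have h1 := HasWeakPartial.regAbs (hε n) hu hloc (hw' j)
      simpa only [hgauge] using h1
    · refine mul_le_mul_right (add_le_add (lintegral_mono fun x => ?_)
        (Finset.sum_le_sum fun j _ => lintegral_mono fun x => ?_)) _
      · exact pow_le_pow_left' (enorm_le_iff_norm_le.2 (hnle n x)) 2
      · exact pow_le_pow_left' (enorm_le_iff_norm_le.2 (norm_re_regSign_mul_le (hε n) _ _)) 2
  have hlim : ∀ x, ‖w x‖ₑ ^ 2 * ‖u x‖ₑ ^ 2 ≤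
      liminf (fun n => ‖w x‖ₑ ^ 2 * ‖(regAbs (ε n) (u x) : ℂ)‖ₑ ^ 2) atTop := by
    intro x
    have h1 : Tendsto (fun n => regAbs (ε n) (u x)) atTop (𝓝 ‖u x‖) := by
      have h2 : Continuous fun e : ℝ => √(‖u x‖ ^ 2 + e ^ 2) - e := by fun_prop
      have h3 := (h2.tendsto 0).comp hε0
      simpa [regAbs, Function.comp_def] using h3
    have h4 := ((Complex.continuous_ofReal.tendsto _).comp h1).enorm
    have h5 : ‖((‖u x‖ : ℝ) : ℂ)‖ₑ = ‖u x‖ₑ := by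
      rw [← ofReal_norm, Complex.norm_real, norm_norm, ofReal_norm]
    rw [h5] at h4
    exact (ENNReal.Tendsto.const_mul (ENNReal.Tendsto.pow h4) (Or.inr (by finiteness))).liminf_eq.ge
  refine (lintegral_mono hlim).trans ?_
  refine (lintegral_liminf_le' fun n => (hw.1.enorm.pow_const 2).mul
    ((hmeas n).enorm.pow_const 2)).trans ?_
  refine (liminf_le_liminf (Eventually.of_forall hn)).trans ?_
  rw [liminf_const]

/-! ### The potentials as weights -/

theorem isSobolevWeight_of_two_lt {N : ℕ} {r : ℝ≥0} (hr : 2 < r)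
    (hN : (3 ≤ N ∧ (r : ℝ) = N) ∨ N = 2) {w : Space N → ℝ} (hw : AEStronglyMeasurable w volume)
    (hb : (⨆ k : Fin N → ℤ, eLpNorm w r (volume.restrict (unitCube k))) < ⊤) :
    IsSobolevWeight w := by
  have hr' : (2 : ℝ) < r := by exact_mod_cast hr
  -- The solution of `1/r + 1/q = 1/2`; for `r = N ≥ 3` it is the critical Sobolev exponent `2N/(N -
  -- 2)`.
  set q : ℝ≥0 := Real.toNNReal (2 * r / (r - 2)) with hq
  have hpos : (0 : ℝ) < r - 2 := by linarith
  have hqr : (q : ℝ) = 2 * r / (r - 2) := Real.coe_toNNReal _ (by positivity)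
  have hqinv : (q : ℝ)⁻¹ = 2⁻¹ - (r : ℝ)⁻¹ := by
    rw [hqr]
    field_simp
  have hq0 : q ≠ 0 := by
    intro h
    rw [h, NNReal.coe_zero] at hqr
    have : (0 : ℝ) < 2 * r / (r - 2) := by positivity
    linarith
  have hT : ENNReal.HolderTriple (r : ℝ≥0∞) q 2 := by
    constructor
    rw [← ENNReal.coe_inv (by positivity), ← ENNReal.coe_inv hq0, ← ENNReal.coe_ofNat,
      ← ENNReal.coe_inv (by norm_num), ← ENNReal.coe_add, ENNReal.coe_inj, ← NNReal.coe_inj]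
    push_cast
    rw [hqinv]
    ring
  have hS : LocalSobolev N q := by
    rcases hN with ⟨h3, hrN⟩ | h2
    · refine localSobolev_of_le (p := 2) (by norm_num) le_rfl ?_ ?_
      · rw [← hrN]
        exact_mod_cast hr
      · rw [hqinv, hrN]
        norm_num
    · subst h2
      -- Chosen so that `1/p - 1/2 = 1/q`, with `p < 2` as the Sobolev inequality in the plane
      -- requires.
      set p : ℝ≥0 := Real.toNNReal (r / (r - 1)) with hp
      have hpos1 : (0 : ℝ) < r - 1 := by linarith
      have hpr : (p : ℝ) = r / (r - 1) := Real.coe_toNNReal _ (by positivity)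
      have hp2 : (p : ℝ) < 2 := by
        rw [hpr, div_lt_iff₀ hpos1]
        linarith
      refine localSobolev_of_le (p := p) ?_ ?_ ?_ ?_
      · rw [← NNReal.coe_le_coe, hpr, NNReal.coe_one, le_div_iff₀ hpos1]
        linarith
      · rw [← NNReal.coe_le_coe]
        exact_mod_cast hp2.le
      · exact_mod_cast hp2
      · rw [hqinv, hpr]
        apply le_of_eq
        push_cast
        field_simp
        ring
  exact isSobolevWeight_of_localSobolev (r := r) hS hw hb

theorem isSobolevWeight_of_one {w : Space 1 → ℝ} (hw : AEStronglyMeasurable w volume)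
    (hb : (⨆ k : Fin 1 → ℤ, eLpNorm w 2 (volume.restrict (unitCube k))) < ⊤) :
    IsSobolevWeight w :=
  isSobolevWeight_of_localSobolev (r := 2) localSobolev_one hw hb

theorem MemLpLoc.locallyIntegrable {N : ℕ} {F : Type*} [NormedAddCommGroup F] {p : ℝ≥0∞}
    (hp : 1 ≤ p) {f : Space N → F} (hf : MemLpLoc p f) : LocallyIntegrable f := by
  rw [locallyIntegrable_iff]
  intro K hK
  have : IsFiniteMeasure (volume.restrict K) :=
    ⟨by rw [Measure.restrict_apply_univ]; exact hK.measure_lt_top⟩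
  exact (hf K hK).integrable hp

theorem isSobolevWeight_norm {N : ℕ} (hN : 1 ≤ N) {A : Space N → Space N} (hA2 : MemLpLoc 2 A)
    (hA : MagneticCondition A) : IsSobolevWeight fun x => ‖A x‖ := by
  have hm : AEStronglyMeasurable (fun x => ‖A x‖) volume :=
    (hA2.locallyIntegrable (by norm_num)).aestronglyMeasurable.norm
  rcases lt_trichotomy N 2 with h | h | h
  · obtain rfl : N = 1 := by omega
    refine isSobolevWeight_of_one hm ?_
    simpa only [eLpNorm_norm] using (hA.2.2 rfl).2
  · obtain ⟨ε, hε, hA'⟩ := hA.2.1 h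
    refine isSobolevWeight_of_two_lt (r := Real.toNNReal (2 + ε)) ?_ (Or.inr h) hm ?_
    · rw [Real.lt_toNNReal_iff_coe_lt]
      simpa using hε
    · simp only [eLpNorm_norm]
      exact hA'.2
  · refine isSobolevWeight_of_two_lt (r := (N : ℝ≥0)) (by exact_mod_cast h)
      (Or.inl ⟨h, by simp⟩) hm ?_
    simpa only [eLpNorm_norm, ENNReal.coe_natCast] using (hA.1 h).2

/-- The `L^r` norm of `|V|^{1/2}` is the square root of the `L^{r/2}` norm of `V`. Thus the
exponents `N/2`, `1 + ε`, `1` for `V` become `N`, `2 + 2ε`, `2` for the weight. -/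
theorem iSup_eLpNorm_sqrt_lt_top {N : ℕ} {V : Space N → ℝ} {r s : ℝ≥0∞} (hrs : r * 2⁻¹ = s)
    (hV : UnifMemLpLoc s V) :
    (⨆ k : Fin N → ℤ, eLpNorm (fun x => ‖V x‖ ^ (1 / 2 : ℝ)) r
      (volume.restrict (unitCube k))) < ⊤ := by
  have h1 : ∀ k : Fin N → ℤ, eLpNorm (fun x => ‖V x‖ ^ (1 / 2 : ℝ)) r
      (volume.restrict (unitCube k)) = eLpNorm V s (volume.restrict (unitCube k)) ^ (1 / 2 : ℝ) := by
    intro k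
    rw [eLpNorm_norm_rpow _ (by norm_num)]
    congr 2
    rw [← hrs]
    congr 1
    rw [one_div, ENNReal.ofReal_inv_of_pos (by norm_num)]
    simp
  simp_rw [h1]
  refine lt_of_le_of_lt (iSup_le fun k => ?_)
    (ENNReal.rpow_lt_top_of_nonneg (y := 1 / 2) (by norm_num) hV.2.ne)
  gcongr
  exact le_iSup (fun k : Fin N → ℤ => eLpNorm V s (volume.restrict (unitCube k))) k

theorem isSobolevWeight_sqrt {N : ℕ} (hN : 1 ≤ N) {V : Space N → ℝ} (hV1 : MemLpLoc 1 V)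
    (hV : ElectricCondition V) : IsSobolevWeight fun x => ‖V x‖ ^ (1 / 2 : ℝ) := by
  have hm : AEStronglyMeasurable (fun x => ‖V x‖ ^ (1 / 2 : ℝ)) volume :=
    (Real.continuous_rpow_const (by norm_num)).comp_aestronglyMeasurable
      (hV1.locallyIntegrable le_rfl).aestronglyMeasurable.norm
  rcases lt_trichotomy N 2 with h | h | h
  · obtain rfl : N = 1 := by omega
    exact isSobolevWeight_of_one hm (iSup_eLpNorm_sqrt_lt_top
      (ENNReal.mul_inv_cancel (by norm_num) (by norm_num)) (hV.2.2 rfl))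
  · obtain ⟨ε, hε, hV'⟩ := hV.2.1 h
    refine isSobolevWeight_of_two_lt (r := Real.toNNReal (2 * (1 + ε))) ?_ (Or.inr h) hm
      (iSup_eLpNorm_sqrt_lt_top ?_ hV')
    · rw [Real.lt_toNNReal_iff_coe_lt]
      push_cast
      linarith
    · rw [← ENNReal.ofReal, ENNReal.ofReal_mul (by norm_num), mul_comm, ← mul_assoc]
      simp [ENNReal.inv_mul_cancel]
  · refine isSobolevWeight_of_two_lt (r := (N : ℝ≥0)) (by exact_mod_cast h)
      (Or.inl ⟨h, by simp⟩) hm (iSup_eLpNorm_sqrt_lt_top ?_ (hV.1 h))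
    rw [ENNReal.coe_natCast, div_eq_mul_inv]

/-! ### Comparison of the weak and magnetic gradients -/

theorem locallyIntegrable_apply {N : ℕ} (F : L2Vec N) (j : Fin N) :
    LocallyIntegrable (fun x => F x j) (volume : Measure (Space N)) := by
  rw [locallyIntegrable_iff]
  intro K hK
  exact (EuclideanSpace.proj (𝕜 := ℂ) j).integrable_comp
    (((Lp.memLp F).locallyIntegrable (by norm_num)).integrableOn_isCompact hK)

theorem integrable_mul_test {N : ℕ} {f φ : Space N → ℂ} (hf : LocallyIntegrable f)
    (hφ : IsTestFunction φ) : Integrable fun x => f x * φ x := by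
  simpa [mul_comm] using hf.integrable_smul_left_of_hasCompactSupport hφ.1.continuous hφ.2

theorem locallyIntegrable_potential_mul {N : ℕ} {A : Space N → Space N} (hA : MemLpLoc 2 A)
    (u : L2 N) (j : Fin N) : LocallyIntegrable fun x => (A x j : ℂ) * u x := by
  rw [locallyIntegrable_iff]
  intro K hK
  have h1 : MemLp (fun x => (A x j : ℂ)) 2 (volume.restrict K) := by
    refine (hA K hK).of_le ?_ (Eventually.of_forall fun x => ?_)
    · exact (Complex.continuous_ofReal.comp
        (EuclideanSpace.proj (𝕜 := ℝ) j).continuous).comp_aestronglyMeasurable (hA K hK).1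
    · rw [Complex.norm_real]
      exact PiLp.norm_apply_le (A x) j
  exact h1.integrable_mul ((Lp.memLp u).restrict K)

theorem sum_lintegral_enorm_apply {N : ℕ} (G : L2Vec N) :
    ∑ j, ∫⁻ x, ‖G x j‖ₑ ^ 2 = ‖G‖ₑ ^ 2 := by
  rw [Lp.enorm_def, eLpNorm_two_sq, ← lintegral_finsetSum']
  · refine lintegral_congr fun x => ?_
    have h : ∑ j, ‖G x j‖₊ ^ 2 = ‖G x‖₊ ^ 2 := by
      rw [← NNReal.coe_inj]
      push_cast
      exact (EuclideanSpace.norm_sq_eq (G x)).symm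
    simp only [enorm_eq_nnnorm]
    exact_mod_cast h
  · intro j _
    exact (locallyIntegrable_apply G j).aestronglyMeasurable.enorm.pow_const 2

/-- The weighted estimate by the magnetic gradient, uniform in the magnetic potential. -/
theorem IsSobolevWeight.lintegral_le_magneticGrad {N : ℕ} {w : Space N → ℝ}
    (hw : IsSobolevWeight w) :
    ∃ C : ℝ≥0, ∀ (A : Space N → Space N) (u : L2 N) (G : L2Vec N), MemLpLoc 2 A →
      IsMagneticGrad A u G →
      ∫⁻ x, ‖w x‖ₑ ^ 2 * ‖u x‖ₑ ^ 2 ≤ C * (‖u‖ₑ ^ 2 + ‖G‖ₑ ^ 2) := by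
  obtain ⟨C, hC⟩ := hw.lintegral_le_magnetic
  refine ⟨C, fun A u G hA hG => ?_⟩
  have hAu := locallyIntegrable_potential_mul hA u
  have hGl := locallyIntegrable_apply G
  have h1 := hC u (fun j x => G x j) A ((Lp.memLp u).locallyIntegrable (by norm_num)) hGl hAu ?_
  · rwa [sum_lintegral_enorm_apply, ← eLpNorm_two_sq, ← Lp.enorm_def] at h1
  · intro j φ hφ
    have h2 : ∀ x, (G x j - I * ((A x j : ℂ) * u x)) * φ x =
        G x j * φ x - I * ((A x j : ℂ) * u x * φ x) := fun x => by ring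
    simp_rw [h2]
    rw [integral_sub (integrable_mul_test (hGl j) hφ)
      ((integrable_mul_test (hAu j) hφ).const_mul I), integral_const_mul, hG φ hφ j]
    ring

/-- Lets the estimate by `∇u` be read off from the magnetic one with zero potential. -/
theorem isMagneticGrad_zero_iff {N : ℕ} {u : L2 N} {G : L2Vec N} :
    IsMagneticGrad 0 u G ↔ IsWeakGrad u G := by
  simp [IsMagneticGrad, IsWeakGrad]

theorem memLpLoc_zero {N : ℕ} : MemLpLoc 2 (0 : Space N → Space N) := fun _ _ => MemLp.zero

/-- If `A u ∈ L²`, the weak gradient and the magnetic gradient differ by `i A u`. -/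
theorem isMagneticGrad_add_iff {N : ℕ} {A : Space N → Space N} {u : L2 N} {F G : L2Vec N}
    (hF : ∀ᵐ x, ∀ j, F x j = (A x j : ℂ) * u x) :
    IsMagneticGrad A u (G + I • F) ↔ IsWeakGrad u G := by
  refine forall_congr' fun φ => forall_congr' fun hφ => forall_congr' fun j => ?_
  have hGi := integrable_mul_test (locallyIntegrable_apply G j) hφ
  have hFi := integrable_mul_test (locallyIntegrable_apply F j) hφ
  have h1 : ∫ x, (G + I • F : L2Vec N) x j * φ x =
      (∫ x, G x j * φ x) + I * ∫ x, F x j * φ x := by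
    rw [← integral_const_mul, ← integral_add hGi (hFi.const_mul I)]
    refine integral_congr_ae ?_
    filter_upwards [Lp.coeFn_add G (I • F), Lp.coeFn_smul I F] with x hx1 hx2
    rw [hx1, Pi.add_apply, hx2]
    simp only [Pi.smul_apply, PiLp.add_apply, PiLp.smul_apply, smul_eq_mul]
    ring
  have h2 : ∫ x, (A x j : ℂ) * u x * φ x = ∫ x, F x j * φ x := by
    refine integral_congr_ae ?_
    filter_upwards [hF] with x hx
    rw [hx j]
  rw [h1, h2]
  exact add_left_inj _

/-- Since `|A u| = |A||u|` pointwise, the weighted integral for `w = |A|` is exactly `‖A u‖²`. -/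
theorem exists_potential_mul {N : ℕ} {A : Space N → Space N} (hA : MemLpLoc 2 A) (u : L2 N)
    (h : ∫⁻ x, ‖‖A x‖‖ₑ ^ 2 * ‖u x‖ₑ ^ 2 < ⊤) :
    ∃ F : L2Vec N, (∀ᵐ x, ∀ j, F x j = (A x j : ℂ) * u x) ∧
      ‖F‖ₑ ^ 2 = ∫⁻ x, ‖‖A x‖‖ₑ ^ 2 * ‖u x‖ₑ ^ 2 := by
  set f : Space N → EuclideanSpace ℂ (Fin N) :=
    fun x => WithLp.toLp 2 fun j => (A x j : ℂ) * u x with hf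
  have hfm : AEStronglyMeasurable f volume := by
    refine (PiLp.continuous_toLp 2 _).comp_aestronglyMeasurable ?_
    exact (aemeasurable_pi_lambda _ fun j =>
      (locallyIntegrable_potential_mul hA u j).aestronglyMeasurable.aemeasurable).aestronglyMeasurable
  have hnorm : ∀ x, ‖f x‖ = ‖A x‖ * ‖u x‖ := by
    intro x
    rw [EuclideanSpace.norm_eq, EuclideanSpace.norm_eq (A x)]
    simp only [hf, norm_mul, Complex.norm_real, mul_pow]
    rw [← Finset.sum_mul, Real.sqrt_mul (by positivity), Real.sqrt_sq (norm_nonneg _)]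
  have hen : ∀ x, ‖f x‖ₑ ^ 2 = ‖‖A x‖‖ₑ ^ 2 * ‖u x‖ₑ ^ 2 := by
    intro x
    rw [← mul_pow, ← enorm_norm (f x), hnorm, enorm_mul, enorm_norm (u x)]
  have hsq : eLpNorm f 2 volume ^ 2 = ∫⁻ x, ‖‖A x‖‖ₑ ^ 2 * ‖u x‖ₑ ^ 2 := by
    rw [eLpNorm_two_sq]
    simp_rw [hen]
  have hmem : MemLp f 2 volume := by
    refine ⟨hfm, ?_⟩
    rw [← hsq] at h
    exact (ENNReal.pow_lt_top_iff.1 h).resolve_right (by norm_num)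
  refine ⟨hmem.toLp f, ?_, ?_⟩
  · filter_upwards [hmem.coeFn_toLp] with x hx j
    rw [hx]
  · rw [Lp.enorm_toLp, hsq]

/-! ### Electric energy and the equivalence of norms -/

theorem exists_pos_le_of_essInf_pos {α : Type*} [MeasurableSpace α] {μ : Measure α} {V : α → ℝ}
    (h : 0 < essInf V μ) : ∃ a : ℝ, 0 < a ∧ ∀ᵐ x ∂μ, a ≤ V x := by
  have h1 : essInf V μ = sSup {a | ∀ᵐ x ∂μ, a ≤ V x} := by
    rw [essInf, liminf_eq]
  rw [h1] at h
  have hne : {a : ℝ | ∀ᵐ x ∂μ, a ≤ V x}.Nonempty := by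
    -- In `ℝ` the supremum of the empty set is `0`, so a positive value forces an almost everywhere
    -- lower bound to exist.
    by_contra hempty
    rw [Set.not_nonempty_iff_eq_empty] at hempty
    rw [hempty, Real.sSup_empty] at h
    exact lt_irrefl _ h
  obtain ⟨a, ha, hpos⟩ := exists_lt_of_lt_csSup hne h
  exact ⟨a, hpos, ha⟩

/-- A bound on `∫ |V| |u|²` makes `V u²` integrable and `∫ V |u|²` comparable with it. -/
theorem electric_bounds {N : ℕ} {V : Space N → ℝ} (hVm : AEStronglyMeasurable V volume) {a : ℝ}
    (haV : ∀ᵐ x, a ≤ V x) (u : L2 N) {R : ℝ≥0}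
    (hR : ∫⁻ x, ‖‖V x‖ ^ (1 / 2 : ℝ)‖ₑ ^ 2 * ‖u x‖ₑ ^ 2 ≤ R) :
    Integrable (fun x => (V x : ℂ) * u x ^ 2) ∧ ∫ x, V x * ‖u x‖ ^ 2 ≤ R ∧
      a * ‖u‖ ^ 2 ≤ ∫ x, V x * ‖u x‖ ^ 2 := by
  have hum := (Lp.memLp u).1
  have hsq : ∀ x, ‖‖V x‖ ^ (1 / 2 : ℝ)‖ₑ ^ 2 = ‖V x‖ₑ := by
    intro x
    rw [← enorm_pow, ← Real.rpow_natCast, ← Real.rpow_mul (norm_nonneg _)]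
    norm_num
  simp_rw [hsq] at hR
  have hi1 : Integrable (fun x => (V x : ℂ) * u x ^ 2) := by
    refine ⟨(Complex.continuous_ofReal.comp_aestronglyMeasurable hVm).mul (hum.pow 2), ?_⟩
    refine lt_of_le_of_lt (le_of_eq ?_) (hR.trans_lt ENNReal.coe_lt_top)
    refine lintegral_congr fun x => ?_
    rw [enorm_mul, enorm_pow, ← enorm_norm (V x : ℂ), Complex.norm_real, enorm_norm]
  have hi2 : Integrable (fun x => V x * ‖u x‖ ^ 2) := by
    refine hi1.mono (hVm.mul (hum.norm.pow 2)) (Eventually.of_forall fun x => ?_)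
    simp
  refine ⟨hi1, ?_, ?_⟩
  · refine (le_abs_self _).trans ?_
    rw [← Real.norm_eq_abs]
    refine (norm_integral_le_lintegral_norm _).trans ?_
    refine ENNReal.toReal_le_coe_of_le_coe (le_trans (le_of_eq ?_) hR)
    refine lintegral_congr fun x => ?_
    rw [ofReal_norm, enorm_mul, enorm_pow, enorm_norm]
  · have h1 : ‖u‖ ^ 2 = ∫ x, ‖u x‖ ^ 2 := by
      have h2 : ‖u‖ₑ ^ 2 = ∫⁻ x, ‖u x‖ₑ ^ 2 := by rw [Lp.enorm_def, eLpNorm_two_sq]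
      rw [integral_eq_lintegral_of_nonneg_ae (f := fun x => ‖u x‖ ^ 2)
        (Eventually.of_forall fun x => sq_nonneg ‖u x‖) (hum.norm.pow 2)]
      have h3 : ∀ x, ENNReal.ofReal (‖u x‖ ^ 2) = ‖u x‖ₑ ^ 2 := fun x => by
        rw [ENNReal.ofReal_pow (norm_nonneg _), ofReal_norm]
      simp_rw [h3]
      rw [← h2, ENNReal.toReal_pow, toReal_enorm]
    have hi3 : Integrable fun x => ‖u x‖ ^ 2 := (Lp.memLp u).integrable_norm_pow (by norm_num)
    rw [h1, ← integral_const_mul]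
    refine integral_mono_ae (hi3.const_mul a) hi2 ?_
    filter_upwards [haV] with x hx
    gcongr

theorem norm_add_smul_sq_le {E : Type*} [NormedAddCommGroup E] [NormedSpace ℂ E] (x y : E) :
    ‖x + I • y‖ ^ 2 ≤ 2 * ‖x‖ ^ 2 + 2 * ‖y‖ ^ 2 := by
  have h := norm_add_le x (I • y)
  rw [norm_smul, Complex.norm_I, one_mul] at h
  nlinarith [norm_nonneg (x + I • y), norm_nonneg x, norm_nonneg y, sq_nonneg (‖x‖ - ‖y‖)]

/-- Each of the two gradients controls the other, and the electric potential. -/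
theorem magnetic_estimates (N : ℕ) (hN : 1 ≤ N) (A : Space N → Space N) (V : Space N → ℝ)
    (hA2 : MemLpLoc 2 A) (hA : MagneticCondition A) (hV1 : MemLpLoc 1 V)
    (hVpos : 0 < essInf V MeasureTheory.volume) (hV : ElectricCondition V) :
    ∃ K a : ℝ, 0 ≤ K ∧ 0 < a ∧
      (∀ (u : L2 N) (G' : L2Vec N), IsMagneticGrad A u G' →
        ∃ G : L2Vec N, IsWeakGrad u G ∧
          ‖G‖ ^ 2 ≤ 2 * ‖G'‖ ^ 2 + K * (‖u‖ ^ 2 + ‖G'‖ ^ 2)) ∧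
      (∀ (u : L2 N) (G : L2Vec N), IsWeakGrad u G →
        MeasureTheory.Integrable (fun x => (V x : ℂ) * u x ^ 2) ∧
        a * ‖u‖ ^ 2 ≤ ∫ x, V x * ‖u x‖ ^ 2 ∧
        ∫ x, V x * ‖u x‖ ^ 2 ≤ K * (‖u‖ ^ 2 + ‖G‖ ^ 2) ∧
        ∃ G' : L2Vec N, IsMagneticGrad A u G' ∧
          ‖G'‖ ^ 2 ≤ 2 * ‖G‖ ^ 2 + K * (‖u‖ ^ 2 + ‖G‖ ^ 2)) := by
  obtain ⟨a, ha, haV⟩ := exists_pos_le_of_essInf_pos hVpos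
  obtain ⟨C₁, hC₁⟩ := (isSobolevWeight_norm hN hA2 hA).lintegral_le_magneticGrad
  obtain ⟨C₂, hC₂⟩ := (isSobolevWeight_sqrt hN hV1 hV).lintegral_le_magneticGrad
  -- Here `F` is always `A u`, while `B` only says which gradient `G` is: it is used with `B = A`
  -- and with `B = 0`.
  have key : ∀ (B : Space N → Space N) (u : L2 N) (G : L2Vec N), MemLpLoc 2 B →
      IsMagneticGrad B u G → ∃ F : L2Vec N,
        (∀ᵐ x, ∀ j, F x j = (A x j : ℂ) * u x) ∧ ‖F‖ ^ 2 ≤ C₁ * (‖u‖ ^ 2 + ‖G‖ ^ 2) := by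
    intro B u G hB hG
    have h1 := hC₁ B u G hB hG
    obtain ⟨F, hF, hFn⟩ := exists_potential_mul hA2 u (h1.trans_lt (by finiteness))
    refine ⟨F, hF, ?_⟩
    rw [← hFn] at h1
    simp only [enorm_eq_nnnorm] at h1
    exact_mod_cast h1
  refine ⟨2 * C₁ + C₂, a, by positivity, ha, fun u G' hG' => ?_, fun u G hG => ?_⟩
  · obtain ⟨F, hF, hFn⟩ := key A u G' hA2 hG'
    refine ⟨G' + Complex.I • (-F), (isMagneticGrad_add_iff hF).1 (by simpa using hG'), ?_⟩
    have h2 := norm_add_smul_sq_le G' (-F)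
    rw [norm_neg] at h2
    have h3 : 0 ≤ (C₂ : ℝ) * (‖u‖ ^ 2 + ‖G'‖ ^ 2) := by positivity
    linarith
  · have hG0 := isMagneticGrad_zero_iff.2 hG
    obtain ⟨F, hF, hFn⟩ := key 0 u G memLpLoc_zero hG0
    have h1 : ∫⁻ x, ‖‖V x‖ ^ (1 / 2 : ℝ)‖ₑ ^ 2 * ‖u x‖ₑ ^ 2 ≤
        ((C₂ * (‖u‖₊ ^ 2 + ‖G‖₊ ^ 2) : NNReal) : ENNReal) := by
      refine (hC₂ 0 u G memLpLoc_zero hG0).trans (le_of_eq ?_)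
      simp only [enorm_eq_nnnorm]
      push_cast
      rfl
    obtain ⟨hi, hle, hge⟩ := electric_bounds
      (hV1.locallyIntegrable le_rfl).aestronglyMeasurable haV u h1
    push_cast at hle
    have h3 : 0 ≤ (C₂ : ℝ) * (‖u‖ ^ 2 + ‖G‖ ^ 2) := by positivity
    have h4 : 0 ≤ (C₁ : ℝ) * (‖u‖ ^ 2 + ‖G‖ ^ 2) := by positivity
    refine ⟨hi, hge, by linarith, G + Complex.I • F, (isMagneticGrad_add_iff hF).2 hG, ?_⟩
    have h2 := norm_add_smul_sq_le G F
    linarith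

end

end MagneticSobolev

theorem mainTheorem3 (N : ℕ) (hN : 1 ≤ N)
    (A : MagneticSobolev.Space N → MagneticSobolev.Space N)
    (V : MagneticSobolev.Space N → ℝ)
    (hA2 : MagneticSobolev.MemLpLoc 2 A)
    (hA : MagneticSobolev.MagneticCondition A)
    (hV1 : MagneticSobolev.MemLpLoc 1 V)
    (hVpos : 0 < essInf V volume)
    (hV : MagneticSobolev.ElectricCondition V) :
    MagneticSobolev.H1AV A V = MagneticSobolev.H1 N ∧
    ∃ c C : ℝ, 0 < c ∧ 0 < C ∧ ∀ u ∈ MagneticSobolev.H1 N,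
      c * MagneticSobolev.H1norm u ≤ MagneticSobolev.H1AVnorm A V u ∧
      MagneticSobolev.H1AVnorm A V u ≤ C * MagneticSobolev.H1norm u := by
  obtain ⟨K, a, hK, ha, hmag, hweak⟩ :=
    MagneticSobolev.magnetic_estimates N hN A V hA2 hA hV1 hVpos hV
  -- The factor `2 + K` passes from one gradient to the other and `1 + a⁻¹` trades `‖u‖²` for the
  -- electric energy. In the upper bound `2 + 2K` adds `K` from the electric energy to `2 + K` from
  -- the magnetic gradient.
  refine ⟨?_, (√((2 + K) * (1 + a⁻¹)))⁻¹, √(2 + 2 * K), by positivity, by positivity, ?_⟩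
  · ext u
    constructor
    · rintro ⟨-, G', hG'⟩
      obtain ⟨G, hG, -⟩ := hmag u G' hG'
      exact ⟨G, hG⟩
    · rintro ⟨G, hG⟩
      obtain ⟨hi, -, -, G', hG', -⟩ := hweak u G hG
      exact ⟨hi, G', hG'⟩
  · rintro u ⟨G, hG⟩
    obtain ⟨-, hge, hle, G', hG', hG'n⟩ := hweak u G hG
    obtain ⟨G₁, hG₁, hGn⟩ := hmag u G' hG'
    obtain rfl := hG₁.unique hG
    rw [MagneticSobolev.H1norm, MagneticSobolev.H1AVnorm, hG.weakGrad_eq, hG'.magneticGrad_eq]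
    set W := ∫ x, V x * ‖u x‖ ^ 2
    constructor
    · rw [inv_mul_le_iff₀ (by positivity), ← Real.sqrt_mul (by positivity)]
      refine Real.sqrt_le_sqrt ?_
      have h1 : ‖u‖ ^ 2 ≤ a⁻¹ * W := by
        rw [le_inv_mul_iff₀ ha]
        exact hge
      have h0 : 0 ≤ W := le_trans (by positivity) hge
      have h2 : ‖u‖ ^ 2 + ‖G'‖ ^ 2 ≤ (1 + a⁻¹) * (W + ‖G'‖ ^ 2) := by
        have : 0 ≤ a⁻¹ * ‖G'‖ ^ 2 := by positivity
        linarith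
      have h3 : ‖u‖ ^ 2 + ‖G₁‖ ^ 2 ≤ (2 + K) * (‖u‖ ^ 2 + ‖G'‖ ^ 2) := by
        have : 0 ≤ ‖u‖ ^ 2 := by positivity
        linarith
      refine h3.trans ?_
      rw [mul_assoc]
      gcongr
    · rw [← Real.sqrt_mul (by positivity)]
      refine Real.sqrt_le_sqrt ?_
      have : 0 ≤ ‖u‖ ^ 2 := by positivity
      linarith
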